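/- **Theorem 5.1.** Let $d\ge 1$ be an integer, $p\ge 1$ and $q\in(1,2]$. There is a constant $C\in(0,\infty)$ depending only on $p,q,d$ such that the following holds. Let $n\ge 1$, let $X_1,\dots,X_n$ be independent random variables with values in $\mathbb R^d$ and common distribution $\mu$, and let $\mu_n=\frac1n\sum_{k=1}^n\delta_{X_k}$ be their empirical measure. For $x\in\mathbb R^d$ let $|x|=\max\{|x_1|,\dots,|x_d|\}$, let $|\cdot|_2$ be the Euclidean norm, let $H(t)=\mu(\{x\in\mathbb R^d:|x|>t\})$, and $$W_p^p(\nu_1,\nu_2)=\inf_{\pi\in\Pi(\nu_1,\nu_2)}\int_{\mathbb R^d\times\mathbb R^d}|x-y|_2^p\,\pi(dx,dy),$$ where $\Pi(\nu_1,\nu_2)$ is the set of probability measures on $\mathbb R^d\times\mathbb R^d$ with margins $\nu_1$ and $\nu_2$. Assume $\int|x|^p\,\mu(dx)<\infty$. Then $W_p^p(\mu_n,\mu)$ is a random variable (that is, measurable), and for every $M>0$: - if $p>d(q-1)/q$, then $$\mathbb E\,W_p^p(\mu_n,\mu)\le C\left(\int_0^\infty t^{p-1}H(t)\mathbf 1_{t>M}\,dt+\frac1{n^{(q-1)/q}}\int_0^\infty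 t^{p-1}H(t)^{1/q}\mathbf 1_{t\le M}\,dt\right);$$ - if $p=d(q-1)/q$ and $n\ge 2$, then $$\mathbb E\,W_p^p(\mu_n,\mu)\le C\left(\int_0^\infty t^{p-1}H(t)\mathbf 1_{t>M}\,dt+\frac{\log n}{n^{p/d}}\int_0^\infty t^{p-1}H(t)^{(d-p)/d}\mathbf 1_{t\le M}\,dt\right);$$ - if $1\le p<d(q-1)/q$, then $$\mathbb E\,W_p^p(\mu_n,\mu)\le C\left(\int_0^\infty t^{p-1}H(t)\mathbf 1_{t>M}\,dt+\frac1{n^{p/d}}\int_0^\infty t^{p-1}H(t)^{(d-p)/d}\mathbf 1_{t\le M}\,dt\right).$$ -/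

import Mathlib

open MeasureTheory ProbabilityTheory Set
open scoped ENNReal NNReal

noncomputable section

/-- The couplings of `ν₁` and `ν₂`: probability measures on the product space with margins
`ν₁` and `ν₂`. -/
def couplings {E : Type*} [MeasurableSpace E] (ν₁ ν₂ : Measure E) : Set (Measure (E × E)) :=
  {π | IsProbabilityMeasure π ∧ π.map Prod.fst = ν₁ ∧ π.map Prod.snd = ν₂}

/-- The `p`-th power `W_p^p(ν₁, ν₂)` of the Wasserstein distance of order `p` on `ℝ^d`, for the
cost given by the Euclidean distance. -/
def wassersteinPow {d : ℕ} (p : ℝ) (ν₁ ν₂ : Measure (EuclideanSpace ℝ (Fin d))) : ℝ≥0∞ :=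
  ⨅ π ∈ couplings ν₁ ν₂, ∫⁻ z, edist z.1 z.2 ^ p ∂π

/-- The empirical measure `(1/n) ∑ δ_{x_k}` of the points `x_1, …, x_n` (meant for `n ≥ 1`). -/
def empiricalMeasure {E : Type*} [MeasurableSpace E] {n : ℕ} (x : Fin n → E) : Measure E :=
  (n : ℝ≥0∞)⁻¹ • ∑ k, Measure.dirac (x k)

/-- The maximum norm `|x| = max {|x_1|, …, |x_d|}` on `ℝ^d`: the norm of the underlying
function in `Fin d → ℝ`, which carries the sup norm. -/
def maxNorm {d : ℕ} (x : EuclideanSpace ℝ (Fin d)) : ℝ := ‖(fun i => x i : Fin d → ℝ)‖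

/-- The tail `H(t) = μ {x : |x| > t}` of `μ` for the maximum norm. -/
def tail {d : ℕ} (μ : Measure (EuclideanSpace ℝ (Fin d))) (t : ℝ) : ℝ≥0∞ :=
  μ {x | t < maxNorm x}

/-- The strong moment `‖X‖_p^p = 𝔼 |X|^p` of a random variable `X` with law `μ`. -/
def strongMoment {d : ℕ} (p : ℝ) (μ : Measure (EuclideanSpace ℝ (Fin d))) : ℝ≥0∞ :=
  ∫⁻ x, ENNReal.ofReal (maxNorm x ^ p) ∂μ

/-- The tail term `∫_0^∞ t^{p-1} H(t) 1_{t > M} dt` (for `M > 0`). -/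
def tailTerm {d : ℕ} (p : ℝ) (μ : Measure (EuclideanSpace ℝ (Fin d))) (M : ℝ) : ℝ≥0∞ :=
  ∫⁻ t in Ioi M, ENNReal.ofReal (t ^ (p - 1)) * tail μ t

/-- The truncated integral `∫_0^∞ t^{p-1} H(t)^a 1_{t ≤ M} dt`. -/
def truncatedTerm {d : ℕ} (p a : ℝ) (μ : Measure (EuclideanSpace ℝ (Fin d))) (M : ℝ) : ℝ≥0∞ :=
  ∫⁻ t in Ioc 0 M, ENNReal.ofReal (t ^ (p - 1)) * tail μ t ^ a

end

/-! ### Transport by matching mass along nested partitions. -/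

section Matching

/-! Cut space into the dyadic annuli `2^m ≤ |x| < 2^(m+1)`, and each annulus at level `l` into cubes
of side `2^(m-l)`. Matching as much mass as possible inside the finest cells, then the leftovers
inside coarser and coarser cells, and finally the rest arbitrarily, gives a coupling. Mass moved at
level `l` could not be matched at level `l+1`, and moving it costs about `2^(p(m-l))`. Hence `W_p^p`
is at most a constant times the sum over `l` and `m` of `2^(-pl) 2^(pm)` times the discrepancies of
the cells (`wassersteinPow_le_tsum_cellDiscrepancy`); the finest term vanishes as the number of
levels grows.

For a cell of mass `a` the expected discrepancy is at most `2a` and at most `(a/n)^(1/2)`, hence at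
most `2 n^(-s) a^(1-s)` for `0 ≤ s ≤ 1/2`. Take `s = (q-1)/q`. The annulus `m` meets at most `4^d
2^(dl)` cubes of level `l`, so by Hölder it contributes at most a constant times `min(h, n^(-s)
2^(dsl) h^(1-s))`, where `h = μ(|x| ≥ 2^m)` (`lintegral_cellDiscrepancy_le`).

Summing over `l` against `2^(-pl)` gives a geometric series whose ratio `2^(ds-p)` is below, at or
above one: these are the three regimes (`exists_level_bound_of_gt`, `exists_level_bound_of_eq`,
`exists_level_bound_of_lt`). The sum over `m` is compared with an integral in `t` (`tsum_scale_le`),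
where the first entry of the minimum serves for `t > M` and the second for `t ≤ M`.

Measurability is separate: `W_p^p(μ_n, μ)` is an infimum of continuous functions of the sample,
hence upper semicontinuous. -/

theorem lintegral_cost_le_of_cell_eq {E ι : Type*} [MeasurableSpace E]
    {c : E × E → ℝ≥0∞} {k : E → ι} {w : E → ℝ≥0∞}
    (hw : Measurable w) {r : ℝ≥0∞} (hc : ∀ x y, k x = k y → c (x, y) ≤ r * w x)
    {π : Measure (E × E)} (hπ : ∀ᵐ z ∂π, k z.1 = k z.2) :
    ∫⁻ z, c z ∂π ≤ r * ∫⁻ x, w x ∂(π.map Prod.fst) := by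
  rw [lintegral_map hw measurable_fst, ← lintegral_const_mul r (by fun_prop)]
  refine lintegral_mono_ae ?_
  filter_upwards [hπ] with z hz using hc _ _ hz

variable {E ι : Type*} [MeasurableSpace E] [MeasurableSpace ι] [Countable ι]
  [MeasurableSingletonClass ι]

theorem sum_restrict_preimage_singleton (μ : Measure E) {k : E → ι} (hk : Measurable k) :
    Measure.sum (fun i => μ.restrict (k ⁻¹' {i})) = μ := by
  rw [← Measure.restrict_iUnion (fun i j hij => Disjoint.preimage k (by simpa using hij))
    (fun i => hk (measurableSet_singleton i))]
  have : ⋃ i, k ⁻¹' {i} = univ := by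
    ext x; simp
  rw [this, Measure.restrict_univ]

theorem lintegral_comp_eq_tsum (μ : Measure E) {k : E → ι} (hk : Measurable k) (w : ι → ℝ≥0∞) :
    ∫⁻ x, w (k x) ∂μ = ∑' i, w i * μ (k ⁻¹' {i}) := by
  have hw : Measurable w := measurable_of_countable w
  rw [← lintegral_map hw hk, lintegral_countable']
  exact tsum_congr fun i => by rw [Measure.map_apply hk (measurableSet_singleton i)]

/-- Two finite measures that agree on the cells of a countable partition have a coupling that
only moves mass inside the cells. -/
theorem exists_coupling_of_cell_eq (μ ν : Measure E) [IsFiniteMeasure μ] [IsFiniteMeasure ν]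
    {k : E → ι} (hk : Measurable k) (h : ∀ i, μ (k ⁻¹' {i}) = ν (k ⁻¹' {i})) :
    ∃ π : Measure (E × E), π.map Prod.fst = μ ∧ π.map Prod.snd = ν ∧
      ∀ᵐ z ∂π, k z.1 = k z.2 := by
  have hm : ∀ i, MeasurableSet (k ⁻¹' {i}) := fun i => hk (measurableSet_singleton i)
  -- The coupling is the normalised product in each cell. In a null cell the factor is `∞`, but it
  -- multiplies the zero measure.
  have key : ∀ i (ρ : Measure E) [IsFiniteMeasure ρ],
      (ρ (k ⁻¹' {i}))⁻¹ • (ρ (k ⁻¹' {i}) • ρ.restrict (k ⁻¹' {i})) = ρ.restrict (k ⁻¹' {i}) := by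
    intro i ρ _
    rcases eq_or_ne (ρ (k ⁻¹' {i})) 0 with h0 | h0
    · rw [Measure.restrict_eq_zero.2 h0]; simp
    · rw [smul_smul, ENNReal.inv_mul_cancel h0 (measure_ne_top _ _), one_smul]
  refine ⟨Measure.sum fun i =>
    (μ (k ⁻¹' {i}))⁻¹ • (μ.restrict (k ⁻¹' {i})).prod (ν.restrict (k ⁻¹' {i})), ?_, ?_, ?_⟩
  · rw [Measure.map_sum measurable_fst.aemeasurable]
    conv_rhs => rw [← sum_restrict_preimage_singleton μ hk]
    congr 1; ext1 i
    rw [Measure.map_smul, Measure.map_fst_prod, Measure.restrict_apply_univ, ← h, key]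
  · rw [Measure.map_sum measurable_snd.aemeasurable]
    conv_rhs => rw [← sum_restrict_preimage_singleton ν hk]
    congr 1; ext1 i
    rw [Measure.map_smul, Measure.map_snd_prod, Measure.restrict_apply_univ, h, key]
  · rw [Measure.ae_sum_iff]
    intro i
    refine Measure.ae_smul_measure ?_ _
    rw [Measure.prod_restrict]
    filter_upwards [ae_restrict_mem ((hm i).prod (hm i))] with z hz
    exact hz.1.trans hz.2.symm

/-- Give `μ` a density that is constant on each cell, the fraction of the mass to be kept; the
complementary density gives the remainder. -/
theorem exists_restriction_of_cell_mass (μ : Measure E) [IsFiniteMeasure μ] {k : E → ι}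
    (hk : Measurable k) (b : ι → ℝ≥0∞) :
    ∃ μ₀ μ₁ : Measure E, μ₀ + μ₁ = μ ∧ (∀ i, μ₀ (k ⁻¹' {i}) = min (μ (k ⁻¹' {i})) (b i)) ∧
      ∀ i, μ₁ (k ⁻¹' {i}) = μ (k ⁻¹' {i}) - b i := by
  have hm : ∀ i, MeasurableSet (k ⁻¹' {i}) := fun i => hk (measurableSet_singleton i)
  let f : ι → ℝ≥0∞ := fun i => min (μ (k ⁻¹' {i})) (b i) / μ (k ⁻¹' {i})
  have hf1 : ∀ i, f i ≤ 1 := fun i =>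
    ENNReal.div_le_of_le_mul (by rw [one_mul]; exact min_le_left _ _)
  have hfm : Measurable fun x => f (k x) := (measurable_of_countable f).comp hk
  have happ : ∀ (g : ι → ℝ≥0∞) (i : ι),
      μ.withDensity (fun x => g (k x)) (k ⁻¹' {i}) = g i * μ (k ⁻¹' {i}) := by
    intro g i
    rw [withDensity_apply _ (hm i), setLIntegral_congr_fun (g := fun _ => g i) (hm i)
      (fun x hx => by rw [show k x = i from hx]), setLIntegral_const]
  have hmul : ∀ i, f i * μ (k ⁻¹' {i}) = min (μ (k ⁻¹' {i})) (b i) := by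
    intro i
    rcases eq_or_ne (μ (k ⁻¹' {i})) 0 with h0 | h0
    · simp [h0]
    · exact ENNReal.div_mul_cancel h0 (measure_ne_top _ _)
  refine ⟨μ.withDensity fun x => f (k x), μ.withDensity fun x => 1 - f (k x), ?_, ?_, ?_⟩
  · rw [← withDensity_add_left hfm]
    have : ((fun x => f (k x)) + fun x => 1 - f (k x)) = 1 := by
      ext x; simp [add_tsub_cancel_of_le (hf1 (k x))]
    rw [this, withDensity_one]
  · intro i; rw [happ, hmul]
  · intro i
    rw [happ (fun j => 1 - f j), ENNReal.sub_mul (fun _ _ => measure_ne_top _ _), one_mul, hmul]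
    rcases le_total (μ (k ⁻¹' {i})) (b i) with h | h
    · rw [min_eq_left h, tsub_self, tsub_eq_zero_of_le h]
    · rw [min_eq_right h]

/-- Matching as much mass as possible inside each cell of a countable partition. -/
theorem exists_matching (μ ν : Measure E) [IsFiniteMeasure μ] [IsFiniteMeasure ν]
    {k : E → ι} (hk : Measurable k) :
    ∃ (π : Measure (E × E)) (μ' ν' : Measure E), π.map Prod.fst + μ' = μ ∧
      π.map Prod.snd + ν' = ν ∧ (∀ᵐ z ∂π, k z.1 = k z.2) ∧
      (∀ i, μ' (k ⁻¹' {i}) = μ (k ⁻¹' {i}) - ν (k ⁻¹' {i})) ∧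
      (∀ i, ν' (k ⁻¹' {i}) = ν (k ⁻¹' {i}) - μ (k ⁻¹' {i})) := by
  obtain ⟨μ₀, μ₁, hμ, hμ₀, hμ₁⟩ :=
    exists_restriction_of_cell_mass μ hk fun i => ν (k ⁻¹' {i})
  obtain ⟨ν₀, ν₁, hν, hν₀, hν₁⟩ :=
    exists_restriction_of_cell_mass ν hk fun i => μ (k ⁻¹' {i})
  have : IsFiniteMeasure μ₀ := isFiniteMeasure_of_le μ (hμ ▸ Measure.le_add_right le_rfl)
  have : IsFiniteMeasure ν₀ := isFiniteMeasure_of_le ν (hν ▸ Measure.le_add_right le_rfl)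
  obtain ⟨π, h1, h2, h3⟩ := exists_coupling_of_cell_eq μ₀ ν₀ hk
    (fun i => by rw [hμ₀, hν₀, min_comm])
  exact ⟨π, μ₁, ν₁, by rw [h1, hμ], by rw [h2, hν], h3, hμ₁, hν₁⟩

/-- Matching mass inside the cells of nested partitions, from the finest one to the coarsest. -/
theorem exists_multiscale_matching {c : E × E → ℝ≥0∞} (w : ι → ℝ≥0∞) (W : E → ℝ≥0∞) (L : ℕ) :
    ∀ (k : ℕ → E → ι) (r : ℕ → ℝ≥0∞), (∀ l, Measurable (k l)) →
      (∀ l x y, k (l + 1) x = k (l + 1) y → k l x = k l y) → (∀ l x, w (k l x) = W x) →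
      (∀ l x y, k l x = k l y → c (x, y) ≤ r l * W x) →
      ∀ (μ ν : Measure E) [IsFiniteMeasure μ] [IsFiniteMeasure ν],
      ∃ (π : Measure (E × E)) (μ' ν' : Measure E), π.map Prod.fst + μ' = μ ∧
        π.map Prod.snd + ν' = ν ∧ (∀ᵐ z ∂π, k 0 z.1 = k 0 z.2) ∧
        (∀ i, μ' (k 0 ⁻¹' {i}) = μ (k 0 ⁻¹' {i}) - ν (k 0 ⁻¹' {i})) ∧
        (∀ i, ν' (k 0 ⁻¹' {i}) = ν (k 0 ⁻¹' {i}) - μ (k 0 ⁻¹' {i})) ∧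
        ∫⁻ z, c z ∂π ≤ r L * ∫⁻ x, W x ∂μ + ∑ l ∈ Finset.range L,
          r l * ∑' i, w i * (μ (k (l + 1) ⁻¹' {i}) - ν (k (l + 1) ⁻¹' {i})) := by
  induction L with
  | zero =>
    intro k r hk _ hw hc μ ν _ _
    have hW : Measurable W := by
      rw [show W = fun x => w (k 0 x) from funext fun x => (hw 0 x).symm]
      exact (measurable_of_countable w).comp (hk 0)
    obtain ⟨π, μ', ν', h1, h2, h3, h4, h5⟩ := exists_matching μ ν (hk 0)
    refine ⟨π, μ', ν', h1, h2, h3, h4, h5, ?_⟩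
    rw [Finset.range_zero, Finset.sum_empty, add_zero]
    refine (lintegral_cost_le_of_cell_eq hW (hc 0) h3).trans ?_
    gcongr
    exact h1 ▸ Measure.le_add_right le_rfl
  | succ L ih =>
    intro k r hk hn hw hc μ ν _ _
    have hW : Measurable W := by
      rw [show W = fun x => w (k 0 x) from funext fun x => (hw 0 x).symm]
      exact (measurable_of_countable w).comp (hk 0)
    -- The induction splits off the coarsest level: the shifted sequences handle levels `1, ...,
    -- L+1`, and level `0` treats what they leave.
    obtain ⟨π₁, μ₁, ν₁, h1, h2, h3, h4, h5, h6⟩ := ih (fun l => k (l + 1)) (fun l => r (l + 1))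
      (fun l => hk _) (fun l => hn _) (fun l => hw _) (fun l => hc _) μ ν
    have : IsFiniteMeasure μ₁ := isFiniteMeasure_of_le μ (h1 ▸ Measure.le_add_left le_rfl)
    have : IsFiniteMeasure ν₁ := isFiniteMeasure_of_le ν (h2 ▸ Measure.le_add_left le_rfl)
    obtain ⟨π₀, μ₀, ν₀, g1, g2, g3, g4, g5⟩ := exists_matching μ₁ ν₁ (hk 0)
    have h3' : ∀ᵐ z ∂π₁, k 0 z.1 = k 0 z.2 := h3.mono fun z hz => hn 0 _ _ hz
    have hm : ∀ i, MeasurableSet (k 0 ⁻¹' {i}) := fun i => hk 0 (measurableSet_singleton i)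
    -- By nesting, `π₁` moves no mass between coarse cells. Its margins therefore agree there, and
    -- removing them from `μ` and `ν` leaves the differences on these cells unchanged.
    have hπeq : ∀ i, π₁.map Prod.fst (k 0 ⁻¹' {i}) = π₁.map Prod.snd (k 0 ⁻¹' {i}) := by
      intro i
      rw [Measure.map_apply measurable_fst (hm i), Measure.map_apply measurable_snd (hm i)]
      refine measure_congr ?_
      filter_upwards [h3'] with z hz
      exact propext (show k 0 z.1 = i ↔ k 0 z.2 = i by rw [hz])
    have hfin : ∀ i, π₁.map Prod.snd (k 0 ⁻¹' {i}) ≠ ∞ := fun i =>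
      ne_top_of_le_ne_top (measure_ne_top ν (k 0 ⁻¹' {i}))
        ((h2 ▸ Measure.le_add_right le_rfl : π₁.map Prod.snd ≤ ν) _)
    have e1 : ∀ i, μ (k 0 ⁻¹' {i}) = π₁.map Prod.snd (k 0 ⁻¹' {i}) + μ₁ (k 0 ⁻¹' {i}) := by
      intro i
      conv_lhs => rw [← h1]
      rw [Measure.add_apply, hπeq]
    have e2 : ∀ i, ν (k 0 ⁻¹' {i}) = π₁.map Prod.snd (k 0 ⁻¹' {i}) + ν₁ (k 0 ⁻¹' {i}) := by
      intro i
      conv_lhs => rw [← h2]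
      rw [Measure.add_apply]
    refine ⟨π₁ + π₀, μ₀, ν₀, ?_, ?_, ?_, ?_, ?_, ?_⟩
    · rw [Measure.map_add _ _ measurable_fst, add_assoc, g1, h1]
    · rw [Measure.map_add _ _ measurable_snd, add_assoc, g2, h2]
    · rw [ae_add_measure_iff]; exact ⟨h3', g3⟩
    · intro i
      rw [g4, e1, e2, ENNReal.add_sub_add_eq_sub_left (hfin i)]
    · intro i
      rw [g5, e1, e2, ENNReal.add_sub_add_eq_sub_left (hfin i)]
    · rw [lintegral_add_measure, Finset.sum_range_succ', ← add_assoc]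
      refine add_le_add h6 ((lintegral_cost_le_of_cell_eq hW (hc 0) g3).trans ?_)
      gcongr
      -- Mass matched at level `0` is part of the leftover of level `1`; this is why the factor `r
      -- l` meets the discrepancy of level `l + 1`.
      calc ∫⁻ x, W x ∂(π₀.map Prod.fst) ≤ ∫⁻ x, W x ∂μ₁ :=
            lintegral_mono' (g1 ▸ Measure.le_add_right le_rfl) le_rfl
        _ = ∫⁻ x, w (k 1 x) ∂μ₁ := by simp_rw [hw]
        _ = _ := by rw [lintegral_comp_eq_tsum _ (hk 1)]; simp_rw [h4]

/-- The discrepancy of two measures on the cells of a partition, with weights. -/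
noncomputable def cellDiscrepancy (w : ι → ℝ≥0∞) (k : E → ι) (μ ν : Measure E) : ℝ≥0∞ :=
  ∑' i, w i * ((μ (k ⁻¹' {i}) - ν (k ⁻¹' {i})) + (ν (k ⁻¹' {i}) - μ (k ⁻¹' {i})))

/-- The transport cost is bounded by the discrepancies on the cells of nested partitions. -/
theorem exists_coupling_lintegral_le {c : E × E → ℝ≥0∞} (w : ι → ℝ≥0∞) (W : E → ℝ≥0∞) (L : ℕ)
    (k : ℕ → E → ι) (r : ℕ → ℝ≥0∞) (A : ℝ≥0∞) (hk : ∀ l, Measurable (k l))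
    (hn : ∀ l x y, k (l + 1) x = k (l + 1) y → k l x = k l y) (hw : ∀ l x, w (k l x) = W x)
    (hc : ∀ l x y, k l x = k l y → c (x, y) ≤ r l * W x)
    (hA : ∀ x y, c (x, y) ≤ A * (W x + W y))
    (μ ν : Measure E) [IsProbabilityMeasure μ] [IsProbabilityMeasure ν] :
    ∃ π ∈ couplings μ ν, ∫⁻ z, c z ∂π ≤ r L * ∫⁻ x, W x ∂μ +
      (A * cellDiscrepancy w (k 0) μ ν +
        ∑ l ∈ Finset.range L, r l * cellDiscrepancy w (k (l + 1)) μ ν) := by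
  have hW : Measurable W := by
    rw [show W = fun x => w (k 0 x) from funext fun x => (hw 0 x).symm]
    exact (measurable_of_countable w).comp (hk 0)
  obtain ⟨π₁, μ₁, ν₁, h1, h2, h3, h4, h5, h6⟩ :=
    exists_multiscale_matching w W L k r hk hn hw hc μ ν
  have : IsFiniteMeasure μ₁ := isFiniteMeasure_of_le μ (h1 ▸ Measure.le_add_left le_rfl)
  have : IsFiniteMeasure ν₁ := isFiniteMeasure_of_le ν (h2 ▸ Measure.le_add_left le_rfl)
  have e1 : π₁ univ + μ₁ univ = 1 := by
    rw [← measure_univ (μ := μ), ← h1, Measure.add_apply,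
      Measure.map_apply measurable_fst .univ, preimage_univ]
  have e2 : π₁ univ + ν₁ univ = 1 := by
    rw [← measure_univ (μ := ν), ← h2, Measure.add_apply,
      Measure.map_apply measurable_snd .univ, preimage_univ]
  have hfin : π₁ univ ≠ ∞ := ne_top_of_le_ne_top ENNReal.one_ne_top (e1 ▸ le_self_add)
  -- The two leftovers have equal total mass, so the one-cell partition couples them.
  obtain ⟨π₀, g1, g2, -⟩ := exists_coupling_of_cell_eq μ₁ ν₁ (k := fun _ => ())
    measurable_const (fun i => by
      simpa using (ENNReal.add_right_inj hfin).1 (e1.trans e2.symm))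
  have f1 : (π₁ + π₀).map Prod.fst = μ := by rw [Measure.map_add _ _ measurable_fst, g1, h1]
  have f2 : (π₁ + π₀).map Prod.snd = ν := by rw [Measure.map_add _ _ measurable_snd, g2, h2]
  refine ⟨π₁ + π₀, ⟨⟨?_⟩, f1, f2⟩, ?_⟩
  · rw [← measure_univ (μ := μ), ← f1, Measure.map_apply measurable_fst .univ, preimage_univ]
  rw [lintegral_add_measure]
  have b1 : ∫⁻ z, c z ∂π₀ ≤ A * cellDiscrepancy w (k 0) μ ν := by
    calc ∫⁻ z, c z ∂π₀ ≤ ∫⁻ z, A * (W z.1 + W z.2) ∂π₀ := lintegral_mono fun z => hA _ _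
      _ = A * (∫⁻ x, W x ∂μ₁ + ∫⁻ x, W x ∂ν₁) := by
          rw [lintegral_const_mul _ (by fun_prop), lintegral_add_left (by fun_prop), ← g1, ← g2,
            lintegral_map hW measurable_fst, lintegral_map hW measurable_snd]
      _ = A * cellDiscrepancy w (k 0) μ ν := by
          have hW' : W = fun x => w (k 0 x) := funext fun x => (hw 0 x).symm
          rw [hW', lintegral_comp_eq_tsum _ (hk 0), lintegral_comp_eq_tsum _ (hk 0),
            ← ENNReal.tsum_add, cellDiscrepancy]
          simp_rw [h4, h5, mul_add]
  have b2 : ∫⁻ z, c z ∂π₁ ≤ r L * ∫⁻ x, W x ∂μ +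
      ∑ l ∈ Finset.range L, r l * cellDiscrepancy w (k (l + 1)) μ ν := by
    refine h6.trans ?_
    gcongr with l
    exact ENNReal.tsum_le_tsum fun i => by gcongr; exact le_self_add
  calc _ ≤ _ := add_le_add b2 b1
    _ = _ := by ring

end Matching

/-! ### Mean discrepancy between the empirical measure and `μ` on one set. -/

section Empirical

variable {E Ω : Type*} [MeasurableSpace E] [MeasurableSpace Ω]

theorem empiricalMeasure_apply {n : ℕ} (x : Fin n → E) {A : Set E} (hA : MeasurableSet A) :
    empiricalMeasure x A = (n : ℝ≥0∞)⁻¹ * ∑ k, A.indicator 1 (x k) := by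
  simp [empiricalMeasure, Measure.dirac_apply' _ hA]

theorem lintegral_empiricalMeasure {n : ℕ} (x : Fin n → E) {f : E → ℝ≥0∞} (hf : Measurable f) :
    ∫⁻ y, f y ∂(empiricalMeasure x) = (n : ℝ≥0∞)⁻¹ * ∑ k, f (x k) := by
  simp [empiricalMeasure, lintegral_dirac' _ hf]

theorem isProbabilityMeasure_empiricalMeasure {n : ℕ} (hn : 1 ≤ n) (x : Fin n → E) :
    IsProbabilityMeasure (empiricalMeasure x) := by
  constructor
  rw [empiricalMeasure_apply x .univ]
  simp only [indicator_univ, Pi.one_apply, Finset.sum_const, Finset.card_univ, Fintype.card_fin,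
    nsmul_eq_mul, mul_one]
  exact ENNReal.inv_mul_cancel (by simp; omega) (ENNReal.natCast_ne_top n)

theorem measurable_empiricalMeasure_apply {n : ℕ} {X : Fin n → Ω → E}
    (hX : ∀ k, Measurable (X k)) {A : Set E} (hA : MeasurableSet A) :
    Measurable fun ω => empiricalMeasure (fun k => X k ω) A := by
  simp_rw [empiricalMeasure_apply _ hA]
  refine Measurable.const_mul (Finset.measurable_sum _ fun k _ => ?_) _
  exact (measurable_one.indicator hA).comp (hX k)

theorem lintegral_empiricalMeasure_apply {P : Measure Ω} {μ : Measure E} {n : ℕ} (hn : 1 ≤ n)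
    {X : Fin n → Ω → E} (hX : ∀ k, Measurable (X k)) (hμ : ∀ k, P.map (X k) = μ)
    {A : Set E} (hA : MeasurableSet A) :
    ∫⁻ ω, empiricalMeasure (fun k => X k ω) A ∂P = μ A := by
  simp_rw [empiricalMeasure_apply _ hA]
  have hm : ∀ k, Measurable fun ω => A.indicator (1 : E → ℝ≥0∞) (X k ω) :=
    fun k => (measurable_one.indicator hA).comp (hX k)
  rw [lintegral_const_mul _ (Finset.measurable_sum _ fun k _ => hm k),
    lintegral_finsetSum _ fun k _ => hm k]
  have : ∀ k, ∫⁻ ω, A.indicator (1 : E → ℝ≥0∞) (X k ω) ∂P = μ A := by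
    intro k
    rw [← lintegral_map (measurable_one.indicator hA) (hX k), hμ, lintegral_indicator_one hA]
  simp only [this, Finset.sum_const, Finset.card_univ, Fintype.card_fin, nsmul_eq_mul]
  rw [← mul_assoc, ENNReal.inv_mul_cancel (by simp; omega) (ENNReal.natCast_ne_top n), one_mul]

theorem tsub_add_tsub_eq_enorm {a b : ℝ≥0∞} (ha : a ≠ ∞) (hb : b ≠ ∞) :
    (a - b) + (b - a) = ‖a.toReal - b.toReal‖ₑ := by
  lift a to ℝ≥0 using ha
  lift b to ℝ≥0 using hb
  simp only [ENNReal.coe_toReal]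
  rw [Real.enorm_eq_ofReal_abs]
  rcases le_total a b with h | h
  · rw [abs_of_nonpos (by simpa using h), tsub_eq_zero_of_le (by simpa using h), zero_add, neg_sub,
      ENNReal.ofReal_sub _ (NNReal.coe_nonneg _)]
    simp
  · rw [abs_of_nonneg (by simpa using h), tsub_eq_zero_of_le (a := (b : ℝ≥0∞)) (by simpa using h),
      add_zero, ENNReal.ofReal_sub _ (NNReal.coe_nonneg _)]
    simp

variable {P : Measure Ω} [IsProbabilityMeasure P] {μ : Measure E}
  {n : ℕ} {X : Fin n → Ω → E}

theorem variance_empiricalMeasure_le (hn : 1 ≤ n) (hX : ∀ k, Measurable (X k))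
    (hI : iIndepFun X P) (hμ : ∀ k, P.map (X k) = μ) {A : Set E} (hA : MeasurableSet A) :
    Var[fun ω => (n : ℝ)⁻¹ * ∑ k, A.indicator (1 : E → ℝ) (X k ω); P] ≤ (μ A).toReal / n := by
  have hi : Measurable (A.indicator (1 : E → ℝ)) := measurable_one.indicator hA
  have hm : ∀ k, Measurable fun ω => A.indicator (1 : E → ℝ) (X k ω) := fun k => hi.comp (hX k)
  have hL : ∀ k, MemLp (fun ω => A.indicator (1 : E → ℝ) (X k ω)) 2 P := fun k =>
    MemLp.of_bound (hm k).aestronglyMeasurable 1 (.of_forall fun ω => by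
      by_cases h : X k ω ∈ A <;> simp [h])
  have hv : ∀ k, Var[fun ω => A.indicator (1 : E → ℝ) (X k ω); P] ≤ (μ A).toReal := by
    intro k
    refine (variance_le_expectation_sq (hm k).aestronglyMeasurable).trans_eq ?_
    have : ((fun ω => A.indicator (1 : E → ℝ) (X k ω)) ^ 2) =
        fun ω => A.indicator (1 : E → ℝ) (X k ω) := by
      ext ω; by_cases h : X k ω ∈ A <;> simp [h]
    rw [this, ← integral_map (φ := X k) (f := A.indicator (1 : E → ℝ)) (hX k).aemeasurable
      hi.aestronglyMeasurable, hμ, integral_indicator_one hA]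
    rfl
  have hn0 : (0 : ℝ) < n := by exact_mod_cast hn
  rw [variance_const_mul]
  have hs : Var[fun ω => ∑ k, A.indicator (1 : E → ℝ) (X k ω); P] =
      ∑ k, Var[fun ω => A.indicator (1 : E → ℝ) (X k ω); P] := by
    have := IndepFun.variance_sum (μ := P) (s := Finset.univ)
      (X := fun k ω => A.indicator (1 : E → ℝ) (X k ω)) (fun k _ => hL k)
      (fun i _ j _ hij => (hI.indepFun hij).comp hi hi)
    rw [← this]
    congr 1; ext ω; simp
  rw [hs]
  calc ((n : ℝ)⁻¹) ^ 2 * ∑ k, Var[fun ω => A.indicator (1 : E → ℝ) (X k ω); P]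
      ≤ ((n : ℝ)⁻¹) ^ 2 * ∑ _k : Fin n, (μ A).toReal := by gcongr with k; exact hv k
    _ = (μ A).toReal / n := by
        simp only [Finset.sum_const, Finset.card_univ, Fintype.card_fin, nsmul_eq_mul]
        field_simp

theorem lintegral_empirical_discrepancy_le_two_mul (hn : 1 ≤ n) (hX : ∀ k, Measurable (X k))
    (hμ : ∀ k, P.map (X k) = μ) {A : Set E} (hA : MeasurableSet A) :
    ∫⁻ ω, ((empiricalMeasure (fun k => X k ω) A - μ A) +
      (μ A - empiricalMeasure (fun k => X k ω) A)) ∂P ≤ 2 * μ A := by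
  calc _ ≤ ∫⁻ ω, (empiricalMeasure (fun k => X k ω) A + μ A) ∂P :=
        lintegral_mono fun ω => add_le_add tsub_le_self tsub_le_self
    _ = 2 * μ A := by
        rw [lintegral_add_right _ measurable_const, lintegral_empiricalMeasure_apply hn hX hμ hA]
        simp [two_mul]

/-- The discrepancy is the absolute deviation of an average from its mean; its `L¹` norm is at most
its `L²` norm, the root of the variance. -/
theorem lintegral_empirical_discrepancy_le_rpow_half [IsProbabilityMeasure μ] (hn : 1 ≤ n)
    (hX : ∀ k, Measurable (X k))
    (hI : iIndepFun X P) (hμ : ∀ k, P.map (X k) = μ) {A : Set E} (hA : MeasurableSet A) :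
    ∫⁻ ω, ((empiricalMeasure (fun k => X k ω) A - μ A) +
      (μ A - empiricalMeasure (fun k => X k ω) A)) ∂P ≤
      ENNReal.ofReal (((μ A).toReal / n) ^ (1 / 2 : ℝ)) := by
  have hp := fun ω => isProbabilityMeasure_empiricalMeasure hn (fun k => X k ω)
  set Z : Ω → ℝ := fun ω => (n : ℝ)⁻¹ * ∑ k, A.indicator (1 : E → ℝ) (X k ω) with hZ
  have hZe : ∀ ω, (empiricalMeasure (fun k => X k ω) A).toReal = Z ω := by
    intro ω
    rw [empiricalMeasure_apply _ hA, ENNReal.toReal_mul, ENNReal.toReal_sum]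
    · simp only [ENNReal.toReal_inv, ENNReal.toReal_natCast, hZ]
      congr 2; ext k
      by_cases h : X k ω ∈ A <;> simp [h]
    · intro k _
      by_cases h : X k ω ∈ A <;> simp [h]
  have hZm : Measurable Z := (Finset.measurable_sum _ fun k _ =>
    (measurable_one.indicator hA).comp (hX k)).const_mul _
  have hn0 : (0 : ℝ) < n := by exact_mod_cast hn
  have hL : MemLp Z 2 P := MemLp.of_bound hZm.aestronglyMeasurable 1 (.of_forall fun ω => by
    rw [← hZe, Real.norm_of_nonneg ENNReal.toReal_nonneg]
    exact ENNReal.toReal_le_of_le_ofReal zero_le_one (by simpa using prob_le_one))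
  have hE : ∫ ω, Z ω ∂P = (μ A).toReal := by
    rw [← lintegral_empiricalMeasure_apply hn hX hμ hA, ← integral_toReal
      (measurable_empiricalMeasure_apply hX hA).aemeasurable
      (.of_forall fun ω => measure_lt_top _ _)]
    simp_rw [hZe]
  have h1 : ∀ ω, (empiricalMeasure (fun k => X k ω) A - μ A) +
      (μ A - empiricalMeasure (fun k => X k ω) A) = ‖Z ω - ∫ ω, Z ω ∂P‖ₑ := by
    intro ω
    rw [tsub_add_tsub_eq_enorm (measure_ne_top _ _) (measure_ne_top _ _), hZe, hE]
  simp_rw [h1]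
  have h2 := eLpNorm_le_eLpNorm_of_exponent_le (μ := P) (p := 1) (q := 2)
    (f := fun ω => Z ω - ∫ ω, Z ω ∂P) (by norm_num) (hZm.sub_const _).aestronglyMeasurable
  rw [eLpNorm_one_eq_lintegral_enorm] at h2
  refine h2.trans ?_
  rw [eLpNorm_eq_lintegral_rpow_enorm_toReal (by norm_num) (by norm_num)]
  have h3 := hL.ofReal_variance_eq
  rw [evariance] at h3
  simp only [ENNReal.toReal_ofNat]
  have h4 : ∫⁻ ω, ‖Z ω - ∫ ω, Z ω ∂P‖ₑ ^ (2 : ℝ) ∂P = ENNReal.ofReal Var[Z; P] := by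
    rw [h3]; simp
  rw [h4, ENNReal.ofReal_rpow_of_nonneg (variance_nonneg _ _) (by norm_num)]
  gcongr
  · exact variance_nonneg _ _
  · exact variance_empiricalMeasure_le hn hX hI hμ hA

/-- Both bounds have the form `m (N m)^(-s)` up to a factor, with `s = 0` and `s = 1/2`. The first
serves when `N m ≤ 1`, the second when `N m ≥ 1`. -/
theorem min_two_mul_rpow_half_le {m N s : ℝ} (hm : 0 < m) (hN : 0 < N) (hs0 : 0 ≤ s)
    (hs : s ≤ 1 / 2) : min (2 * m) ((m / N) ^ (1 / 2 : ℝ)) ≤ 2 * N ^ (-s) * m ^ (1 - s) := by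
  have key : N ^ (-s) * m ^ (1 - s) = m * (N * m) ^ (-s) := by
    rw [Real.mul_rpow hN.le hm.le, sub_eq_add_neg, Real.rpow_add hm, Real.rpow_one]; ring
  rw [mul_assoc, key]
  rcases le_total (N * m) 1 with h | h
  · refine (min_le_left _ _).trans ?_
    have : 1 ≤ (N * m) ^ (-s) :=
      Real.one_le_rpow_of_pos_of_le_one_of_nonpos (by positivity) h (by linarith)
    nlinarith
  · refine (min_le_right _ _).trans ?_
    have h1 : (m / N) ^ (1 / 2 : ℝ) = m * (N * m) ^ (-(1 / 2) : ℝ) := by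
      rw [Real.rpow_neg (by positivity), ← Real.sqrt_eq_rpow, ← Real.sqrt_eq_rpow,
        Real.sqrt_mul hN.le, Real.sqrt_div hm.le]
      have := Real.sq_sqrt hm.le
      have h0 : 0 < √m := Real.sqrt_pos.2 hm
      have h0' : 0 < √N := Real.sqrt_pos.2 hN
      field_simp
      exact this
    have h2 : (N * m) ^ (-(1 / 2) : ℝ) ≤ (N * m) ^ (-s) :=
      Real.rpow_le_rpow_of_exponent_le h (by linarith)
    have h3 : 0 ≤ (N * m) ^ (-s) := by positivity
    rw [h1]
    nlinarith [mul_le_mul_of_nonneg_left h2 hm.le, mul_nonneg hm.le h3]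

theorem lintegral_empirical_discrepancy_le_rpow [IsProbabilityMeasure μ] (hn : 1 ≤ n)
    (hX : ∀ k, Measurable (X k))
    (hI : iIndepFun X P) (hμ : ∀ k, P.map (X k) = μ) {A : Set E} (hA : MeasurableSet A)
    {s : ℝ} (hs0 : 0 ≤ s) (hs : s ≤ 1 / 2) :
    ∫⁻ ω, ((empiricalMeasure (fun k => X k ω) A - μ A) +
      (μ A - empiricalMeasure (fun k => X k ω) A)) ∂P ≤
      2 * ENNReal.ofReal ((n : ℝ) ^ (-s)) * μ A ^ (1 - s) := by
  have h1 := lintegral_empirical_discrepancy_le_two_mul (P := P) hn hX hμ hA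
  have h2 := lintegral_empirical_discrepancy_le_rpow_half hn hX hI hμ hA
  rcases eq_or_ne (μ A) 0 with h0 | h0
  · rw [h0, mul_zero] at h1
    rw [h0]; exact h1.trans zero_le
  have hm : 0 < (μ A).toReal := ENNReal.toReal_pos h0 (measure_ne_top _ _)
  have hn0 : (0 : ℝ) < n := by exact_mod_cast hn
  have hA' : μ A = ENNReal.ofReal (μ A).toReal := (ENNReal.ofReal_toReal (measure_ne_top _ _)).symm
  have h1' : (2 : ℝ≥0∞) * μ A = ENNReal.ofReal (2 * (μ A).toReal) := by
    rw [ENNReal.ofReal_mul zero_le_two, ← hA']; simp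
  rw [h1'] at h1
  have h3 := le_min h1 h2
  rw [← ENNReal.ofReal_min] at h3
  refine (h3.trans (ENNReal.ofReal_le_ofReal
    (min_two_mul_rpow_half_le hm hn0 hs0 hs))).trans_eq ?_
  rw [ENNReal.ofReal_mul (by positivity), ENNReal.ofReal_mul zero_le_two,
    ← ENNReal.ofReal_rpow_of_pos hm, ← hA']
  simp

end Empirical

/-! ### Dyadic annuli and cubes, and the deterministic bound of the transport cost. -/

section Dyadic

variable {d : ℕ}

theorem measurable_maxNorm : Measurable (maxNorm : EuclideanSpace ℝ (Fin d) → ℝ) := by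
  unfold maxNorm
  fun_prop

theorem maxNorm_nonneg (x : EuclideanSpace ℝ (Fin d)) : 0 ≤ maxNorm x := norm_nonneg _

theorem abs_apply_le_maxNorm (x : EuclideanSpace ℝ (Fin d)) (i : Fin d) : |x i| ≤ maxNorm x :=
  norm_le_pi_norm (fun i => x i : Fin d → ℝ) i

theorem maxNorm_eq_zero {x : EuclideanSpace ℝ (Fin d)} : maxNorm x = 0 ↔ x = 0 := by
  rw [maxNorm, norm_eq_zero]
  constructor
  · intro h; ext i; exact congrFun h i
  · rintro rfl; rfl

theorem maxNorm_pos {x : EuclideanSpace ℝ (Fin d)} (hx : x ≠ 0) : 0 < maxNorm x :=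
  (maxNorm_nonneg x).lt_of_ne fun h => hx (maxNorm_eq_zero.1 h.symm)

theorem norm_le_of_abs_apply_le {x : EuclideanSpace ℝ (Fin d)} {r : ℝ} (hr : 0 ≤ r)
    (h : ∀ i, |x i| ≤ r) : ‖x‖ ≤ d * r := by
  rw [EuclideanSpace.norm_eq]
  refine Real.sqrt_le_iff.2 ⟨by positivity, ?_⟩
  calc ∑ i, ‖x i‖ ^ 2 ≤ ∑ _i : Fin d, r ^ 2 := by
        gcongr with i; exact h i
    _ = d * r ^ 2 := by simp
    _ ≤ d ^ 2 * r ^ 2 := by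
        gcongr
        exact_mod_cast Nat.le_self_pow two_ne_zero d
    _ = (d * r) ^ 2 := by ring

theorem norm_le_mul_maxNorm (x : EuclideanSpace ℝ (Fin d)) : ‖x‖ ≤ d * maxNorm x :=
  norm_le_of_abs_apply_le (maxNorm_nonneg x) (abs_apply_le_maxNorm x)

theorem edist_rpow_le_ofReal {x y : EuclideanSpace ℝ (Fin d)} {p r : ℝ} (hp : 0 ≤ p)
    (h : dist x y ≤ r) : edist x y ^ p ≤ ENNReal.ofReal (r ^ p) := by
  rw [edist_dist, ENNReal.ofReal_rpow_of_nonneg dist_nonneg hp]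
  gcongr

/-- The index of the dyadic annulus `{2^m ≤ |x| < 2^(m+1)}` that contains `x`. -/
noncomputable def annulusIndex (x : EuclideanSpace ℝ (Fin d)) : ℤ := Int.log 2 (maxNorm x)

/-- The index of the cell of level `l` containing `x`: the annulus, and in it the cube of side
`2^(m-l)`. -/
noncomputable def dyadicCell (l : ℕ) (x : EuclideanSpace ℝ (Fin d)) : ℤ × (Fin d → ℤ) :=
  (annulusIndex x, fun i => ⌊x i * (2 : ℝ) ^ ((l : ℤ) - annulusIndex x)⌋)

/-- The weight `2^(pm)` of the cells in the annulus `m`; the cell `{0}` has weight zero. -/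
noncomputable def cellWeight (p : ℝ) (i : ℤ × (Fin d → ℤ)) : ℝ≥0∞ :=
  if i.2 = 0 then 0 else ENNReal.ofReal ((2 : ℝ) ^ (p * i.1))

theorem measurable_annulusIndex :
    Measurable (annulusIndex : EuclideanSpace ℝ (Fin d) → ℤ) := by
  have : (annulusIndex : EuclideanSpace ℝ (Fin d) → ℤ) =
      fun x => ⌊Real.logb 2 (maxNorm x)⌋ := by
    ext x
    have := Real.floor_logb_natCast (b := 2) (maxNorm_nonneg x)
    rw [annulusIndex, ← this]; rfl
  rw [this]
  unfold Real.logb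
  have := measurable_maxNorm (d := d)
  fun_prop

theorem measurable_dyadicCell (l : ℕ) :
    Measurable (dyadicCell l : EuclideanSpace ℝ (Fin d) → ℤ × (Fin d → ℤ)) := by
  have h := measurable_annulusIndex (d := d)
  refine h.prodMk (measurable_pi_lambda _ fun i => ?_)
  have h2 : Measurable fun x : EuclideanSpace ℝ (Fin d) =>
      (2 : ℝ) ^ ((l : ℤ) - annulusIndex x) :=
    (measurable_of_countable fun m : ℤ => (2 : ℝ) ^ ((l : ℤ) - m)).comp h
  exact Int.measurable_floor.comp ((by fun_prop : Measurable fun x : EuclideanSpace ℝ (Fin d) =>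
    x i).mul h2)

theorem floor_eq_floor_of_floor_two_mul_eq {x y : ℝ} (h : ⌊x * 2⌋ = ⌊y * 2⌋) : ⌊x⌋ = ⌊y⌋ := by
  have key : ∀ z : ℝ, ⌊z⌋ = ⌊z * 2⌋ / 2 := by
    intro z
    have h1 : 2 * ⌊z⌋ ≤ ⌊z * 2⌋ := by
      rw [Int.le_floor]; push_cast; linarith [Int.floor_le z]
    have h2 : ⌊z * 2⌋ < 2 * ⌊z⌋ + 2 := by
      rw [Int.floor_lt]; push_cast; linarith [Int.lt_floor_add_one z]
    omega
  rw [key x, key y, h]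

theorem dyadicCell_nested (l : ℕ) (x y : EuclideanSpace ℝ (Fin d))
    (h : dyadicCell (l + 1) x = dyadicCell (l + 1) y) : dyadicCell l x = dyadicCell l y := by
  simp only [dyadicCell, Prod.mk.injEq] at h ⊢
  obtain ⟨h1, h2⟩ := h
  refine ⟨h1, ?_⟩
  rw [h1] at h2 ⊢
  ext i
  refine floor_eq_floor_of_floor_two_mul_eq ?_
  have := congrFun h2 i
  have e : ((l + 1 : ℕ) : ℤ) - annulusIndex y = (l - annulusIndex y) + 1 := by push_cast; ring
  rwa [e, zpow_add_one₀ two_ne_zero, ← mul_assoc, ← mul_assoc] at this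

theorem zpow_annulusIndex_le {x : EuclideanSpace ℝ (Fin d)} (hx : x ≠ 0) :
    (2 : ℝ) ^ annulusIndex x ≤ maxNorm x := by
  exact_mod_cast Int.zpow_log_le_self one_lt_two (maxNorm_pos hx)

theorem maxNorm_lt_zpow (x : EuclideanSpace ℝ (Fin d)) :
    maxNorm x < (2 : ℝ) ^ (annulusIndex x + 1) := by
  exact_mod_cast Int.lt_zpow_succ_log_self one_lt_two (maxNorm x)

/-- A nonzero point has a coordinate of size at least `2^m`, too large for the cube with index zero.
So the origin is a cell of its own, which can carry weight zero although its annulus index is a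
default value. -/
theorem dyadicCell_snd_eq_zero_iff (l : ℕ) (x : EuclideanSpace ℝ (Fin d)) :
    (dyadicCell l x).2 = 0 ↔ x = 0 := by
  constructor
  · intro h
    by_contra hx
    have h1 := zpow_annulusIndex_le hx
    have hpos : (0 : ℝ) < 2 ^ annulusIndex x := by positivity
    have h2 : maxNorm x < 2 ^ annulusIndex x := by
      rw [maxNorm, pi_norm_lt_iff hpos]
      intro i
      have h3 : ⌊x i * (2 : ℝ) ^ ((l : ℤ) - annulusIndex x)⌋ = 0 := congrFun h i
      rw [Int.floor_eq_zero_iff, zpow_sub₀ two_ne_zero, zpow_natCast, mul_div_assoc', mem_Ico,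
        div_lt_one hpos] at h3
      have h4 : 0 ≤ x i := by
        by_contra! hneg
        have : x i * 2 ^ l / (2 : ℝ) ^ annulusIndex x < 0 :=
          div_neg_of_neg_of_pos (mul_neg_of_neg_of_pos hneg (by positivity)) hpos
        linarith [h3.1]
      rw [Real.norm_of_nonneg h4]
      have : (1 : ℝ) ≤ 2 ^ l := one_le_pow₀ one_le_two
      nlinarith [h3.2]
    linarith
  · rintro rfl
    ext i
    simp [dyadicCell]

/-- The weight of the cell around a point is the same at every level, as the multiscale matching
requires. -/
theorem cellWeight_dyadicCell (p : ℝ) (l : ℕ) (x : EuclideanSpace ℝ (Fin d)) :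
    cellWeight p (dyadicCell l x) =
      if x = 0 then 0 else ENNReal.ofReal ((2 : ℝ) ^ (p * annulusIndex x)) := by
  simp only [cellWeight, dyadicCell_snd_eq_zero_iff]
  rfl

theorem rpow_mul_intCast (p : ℝ) (m : ℤ) : (2 : ℝ) ^ (p * m) = ((2 : ℝ) ^ m) ^ p := by
  rw [mul_comm, Real.rpow_mul zero_le_two, Real.rpow_intCast]

theorem edist_rpow_le_of_dyadicCell_eq {p : ℝ} (hp : 1 ≤ p) (l : ℕ)
    (x y : EuclideanSpace ℝ (Fin d)) (h : dyadicCell l x = dyadicCell l y) :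
    edist x y ^ p ≤ ENNReal.ofReal ((d * ((2 : ℝ) ^ l)⁻¹) ^ p) * cellWeight p (dyadicCell 0 x) := by
  have hp0 : 0 < p := by linarith
  rw [cellWeight_dyadicCell]
  split_ifs with hx
  · have hy : y = 0 := by
      rw [← dyadicCell_snd_eq_zero_iff l, ← h, dyadicCell_snd_eq_zero_iff, hx]
    simp [hx, hy, hp0]
  · rw [← ENNReal.ofReal_mul (by positivity), rpow_mul_intCast,
      ← Real.mul_rpow (by positivity) (by positivity)]
    refine edist_rpow_le_ofReal hp0.le ?_
    rw [dist_eq_norm, mul_assoc]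
    refine norm_le_of_abs_apply_le (by positivity) fun i => ?_
    simp only [dyadicCell, Prod.mk.injEq] at h
    obtain ⟨h1, h2⟩ := h
    rw [← h1] at h2
    have h3 := Int.abs_sub_lt_one_of_floor_eq_floor (congrFun h2 i)
    rw [← sub_mul, abs_mul, zpow_sub₀ two_ne_zero, zpow_natCast,
      abs_of_pos (a := (2 : ℝ) ^ l / _) (by positivity), ← lt_div_iff₀ (by positivity)] at h3
    refine h3.le.trans_eq ?_
    rw [one_div_div, div_eq_inv_mul]

theorem edist_rpow_le_add_cellWeight {p : ℝ} (hp : 1 ≤ p) (x y : EuclideanSpace ℝ (Fin d)) :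
    edist x y ^ p ≤ ENNReal.ofReal ((4 * d) ^ p) *
      (cellWeight p (dyadicCell 0 x) + cellWeight p (dyadicCell 0 y)) := by
  have hp0 : 0 < p := by linarith
  have key : ∀ z : EuclideanSpace ℝ (Fin d), ENNReal.ofReal ((2 * d * maxNorm z) ^ p) ≤
      ENNReal.ofReal ((4 * d) ^ p) * cellWeight p (dyadicCell 0 z) := by
    intro z
    rw [cellWeight_dyadicCell]
    split_ifs with hz
    · simp [maxNorm_eq_zero.2 hz, hp0.ne']
    · rw [← ENNReal.ofReal_mul (by positivity), rpow_mul_intCast,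
        ← Real.mul_rpow (by positivity) (by positivity)]
      have h1 := maxNorm_lt_zpow z
      rw [zpow_add_one₀ two_ne_zero] at h1
      have h2 : 2 * d * maxNorm z ≤ 4 * d * (2 : ℝ) ^ annulusIndex z := by
        calc 2 * d * maxNorm z ≤ 2 * d * ((2 : ℝ) ^ annulusIndex z * 2) := by gcongr
          _ = _ := by ring
      have := maxNorm_nonneg z
      gcongr
  have hd : dist x y ≤ d * maxNorm x + d * maxNorm y := by
    rw [dist_eq_norm]
    exact (norm_sub_le _ _).trans (add_le_add (norm_le_mul_maxNorm _) (norm_le_mul_maxNorm _))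
  rw [mul_add]
  rcases le_total (maxNorm x) (maxNorm y) with h | h
  · refine (edist_rpow_le_ofReal hp0.le (hd.trans ?_)).trans ((key y).trans le_add_self)
    calc d * maxNorm x + d * maxNorm y ≤ d * maxNorm y + d * maxNorm y := by gcongr
      _ = _ := by ring
  · refine (edist_rpow_le_ofReal hp0.le (hd.trans ?_)).trans ((key x).trans le_self_add)
    calc d * maxNorm x + d * maxNorm y ≤ d * maxNorm x + d * maxNorm x := by gcongr
      _ = _ := by ring

theorem lintegral_cellWeight_le_strongMoment {p : ℝ} (hp : 1 ≤ p)
    (μ : Measure (EuclideanSpace ℝ (Fin d))) :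
    ∫⁻ x, cellWeight p (dyadicCell 0 x) ∂μ ≤ strongMoment p μ := by
  refine lintegral_mono fun x => ?_
  rw [cellWeight_dyadicCell]
  split_ifs with hx
  · exact zero_le
  · rw [rpow_mul_intCast]
    have := zpow_annulusIndex_le hx
    gcongr

/-- The Wasserstein distance is bounded by the discrepancies on the dyadic cells. -/
theorem wassersteinPow_le_tsum_cellDiscrepancy {p : ℝ} (hp : 1 ≤ p)
    (μ ν : Measure (EuclideanSpace ℝ (Fin d))) [IsProbabilityMeasure μ] [IsProbabilityMeasure ν]
    (hμ : strongMoment p μ < ∞) :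
    wassersteinPow p μ ν ≤ ENNReal.ofReal ((4 * d) ^ p) *
      ∑' l : ℕ, ENNReal.ofReal (((2 : ℝ) ^ (-p)) ^ l) *
        cellDiscrepancy (cellWeight p) (dyadicCell l) μ ν := by
  have hp0 : 0 < p := by linarith
  have hr : ∀ l : ℕ, (d * ((2 : ℝ) ^ l)⁻¹) ^ p = (d : ℝ) ^ p * ((2 : ℝ) ^ (-p)) ^ l := by
    intro l
    rw [Real.mul_rpow (by positivity) (by positivity), Real.inv_rpow (by positivity),
      ← Real.rpow_natCast_mul zero_le_two, mul_comm (l : ℝ), Real.rpow_mul_natCast zero_le_two,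
      Real.rpow_neg zero_le_two, inv_pow]
  set I := ∫⁻ x, cellWeight p (dyadicCell 0 x) ∂μ with hI
  have hIfin : I ≠ ∞ := ((lintegral_cellWeight_le_strongMoment hp μ).trans_lt hμ).ne
  set A := ENNReal.ofReal ((4 * d) ^ p)
  set D := fun l => cellDiscrepancy (cellWeight p) (dyadicCell l) μ ν
  set S := A * ∑' l : ℕ, ENNReal.ofReal (((2 : ℝ) ^ (-p)) ^ l) * D l
  have h2p : (2 : ℝ) ^ (-p) < 1 := Real.rpow_lt_one_of_one_lt_of_neg one_lt_two (by linarith)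
  have main : ∀ L : ℕ, wassersteinPow p μ ν ≤
      ENNReal.ofReal ((d * ((2 : ℝ) ^ L)⁻¹) ^ p) * I + S := by
    intro L
    obtain ⟨π, hπ, hle⟩ := exists_coupling_lintegral_le (c := fun z => edist z.1 z.2 ^ p)
      (cellWeight p) (fun x => cellWeight p (dyadicCell 0 x)) L dyadicCell
      (fun l => ENNReal.ofReal ((d * ((2 : ℝ) ^ l)⁻¹) ^ p)) A measurable_dyadicCell
      dyadicCell_nested (fun l x => by simp only [cellWeight_dyadicCell])
      (edist_rpow_le_of_dyadicCell_eq hp) (edist_rpow_le_add_cellWeight hp) μ ν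
    refine (iInf₂_le π hπ).trans (hle.trans ?_)
    gcongr
    -- The shift of levels costs a factor `2^p`, since `d^p 2^(-pl) = (2d)^p 2^(-p(l+1))`; `A =
    -- (4d)^p` absorbs it.
    calc A * D 0 + ∑ l ∈ Finset.range L, ENNReal.ofReal ((d * ((2 : ℝ) ^ l)⁻¹) ^ p) * D (l + 1)
        ≤ ∑ l ∈ Finset.range L, A * (ENNReal.ofReal (((2 : ℝ) ^ (-p)) ^ (l + 1)) * D (l + 1)) +
          A * (ENNReal.ofReal (((2 : ℝ) ^ (-p)) ^ 0) * D 0) := by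
          rw [add_comm, pow_zero, ENNReal.ofReal_one, one_mul]
          refine add_le_add (Finset.sum_le_sum fun l _ => ?_) le_rfl
          rw [← mul_assoc]
          refine mul_le_mul_left ?_ _
          rw [← ENNReal.ofReal_mul (by positivity)]
          gcongr
          rw [hr, pow_succ', ← mul_assoc, Real.rpow_neg zero_le_two, ← div_eq_mul_inv,
            ← Real.div_rpow (by positivity) zero_le_two]
          gcongr
          have : (0 : ℝ) ≤ d := by positivity
          linarith
      _ = ∑ l ∈ Finset.range (L + 1), A * (ENNReal.ofReal (((2 : ℝ) ^ (-p)) ^ l) * D l) :=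
          (Finset.sum_range_succ'
            (fun l => A * (ENNReal.ofReal (((2 : ℝ) ^ (-p)) ^ l) * D l)) L).symm
      _ ≤ S := by
          rw [← Finset.mul_sum]
          exact mul_le_mul_right (ENNReal.sum_le_tsum _) _
  -- Finiteness of the moment makes the cost inside the finest cells tend to zero.
  have hlim : Filter.Tendsto (fun L : ℕ => ENNReal.ofReal ((d * ((2 : ℝ) ^ L)⁻¹) ^ p) * I + S)
      Filter.atTop (nhds (0 * I + S)) := by
    refine Filter.Tendsto.add_const _ (ENNReal.Tendsto.mul_const ?_ (Or.inr hIfin))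
    rw [← ENNReal.ofReal_zero]
    refine ENNReal.tendsto_ofReal ?_
    simp_rw [hr]
    simpa using (tendsto_pow_atTop_nhds_zero_of_lt_one (by positivity) h2p).const_mul ((d : ℝ) ^ p)
  simpa using ge_of_tendsto' hlim main

theorem zpow_le_maxNorm_of_dyadicCell_eq {l : ℕ} {m : ℤ} {j : Fin d → ℤ} (hj : j ≠ 0)
    {x : EuclideanSpace ℝ (Fin d)} (h : dyadicCell l x = (m, j)) : (2 : ℝ) ^ m ≤ maxNorm x := by
  have hx : x ≠ 0 := by
    rintro rfl
    exact hj (by rw [← (dyadicCell_snd_eq_zero_iff l 0).2 rfl, h])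
  have : annulusIndex x = m := congrArg Prod.fst h
  exact this ▸ zpow_annulusIndex_le hx

/-- The cubes of level `l` that meet an annulus. -/
noncomputable def cubeIndices (d l : ℕ) : Finset (Fin d → ℤ) :=
  (Fintype.piFinset fun _ => Finset.Ico (-2 ^ (l + 1)) (2 ^ (l + 1))).erase 0

theorem card_cubeIndices_le (d l : ℕ) : (cubeIndices d l).card ≤ 4 ^ d * (2 ^ d) ^ l := by
  refine (Finset.card_erase_le).trans_eq ?_
  rw [Fintype.card_piFinset_const, Int.card_Ico]
  have : ((2 ^ (l + 1) - -2 ^ (l + 1) : ℤ)).toNat = 4 * 2 ^ l := by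
    have : (2 ^ (l + 1) - -2 ^ (l + 1) : ℤ) = ((4 * 2 ^ l : ℕ) : ℤ) := by push_cast; ring
    rw [this, Int.toNat_natCast]
  rw [this, mul_pow, ← pow_mul, ← pow_mul, mul_comm d l]

theorem mem_cubeIndices_of_dyadicCell_eq {l : ℕ} {m : ℤ} {j : Fin d → ℤ} (hj : j ≠ 0)
    {x : EuclideanSpace ℝ (Fin d)} (h : dyadicCell l x = (m, j)) : j ∈ cubeIndices d l := by
  refine Finset.mem_erase.2 ⟨hj, Fintype.mem_piFinset.2 fun i => ?_⟩
  simp only [dyadicCell, Prod.mk.injEq] at h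
  obtain ⟨h1, rfl⟩ := h
  have h2 := maxNorm_lt_zpow x
  have h3 : |x i * (2 : ℝ) ^ ((l : ℤ) - annulusIndex x)| < 2 ^ (l + 1) := by
    rw [abs_mul, abs_of_pos (a := (2 : ℝ) ^ ((l : ℤ) - annulusIndex x)) (by positivity)]
    calc |x i| * (2 : ℝ) ^ ((l : ℤ) - annulusIndex x)
        < (2 : ℝ) ^ (annulusIndex x + 1) * (2 : ℝ) ^ ((l : ℤ) - annulusIndex x) := by
          gcongr
          exact (abs_apply_le_maxNorm x i).trans_lt h2
      _ = 2 ^ (l + 1) := by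
          rw [← zpow_add₀ two_ne_zero, ← zpow_natCast]
          congr 1; push_cast; ring
  rw [abs_lt] at h3
  rw [Finset.mem_Ico, Int.le_floor, Int.floor_lt]
  push_cast
  exact ⟨h3.1.le, h3.2⟩

end Dyadic

/-! ### Expected discrepancies, summed over cubes and annuli. -/

section Expectation

/-- Hölder's inequality, from the power mean inequality with exponent `1/(1-s)`. -/
theorem sum_rpow_one_sub_le {ι : Type*} (t : Finset ι) (f : ι → ℝ≥0∞) {s : ℝ} (hs0 : 0 ≤ s)
    (hs1 : s < 1) :
    ∑ i ∈ t, f i ^ (1 - s) ≤ (t.card : ℝ≥0∞) ^ s * (∑ i ∈ t, f i) ^ (1 - s) := by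
  have h1s : 0 < 1 - s := by linarith
  have h := ENNReal.rpow_sum_le_const_mul_sum_rpow t (fun i => f i ^ (1 - s))
    (p := (1 - s)⁻¹) ((one_le_inv₀ h1s).2 (by linarith))
  simp only [← ENNReal.rpow_mul, mul_inv_cancel₀ h1s.ne', ENNReal.rpow_one] at h
  have h2 := ENNReal.rpow_le_rpow h h1s.le
  rw [← ENNReal.rpow_mul, inv_mul_cancel₀ h1s.ne', ENNReal.rpow_one,
    ENNReal.mul_rpow_of_nonneg _ _ h1s.le, ← ENNReal.rpow_mul] at h2
  convert h2 using 3
  field_simp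
  ring

theorem min_mul_le_mul_min {a t c : ℝ≥0∞} (hc : 1 ≤ c) : min a (c * t) ≤ c * min a t := by
  rcases le_total a t with h | h
  · rw [min_eq_left h]
    exact (min_le_left _ _).trans (le_mul_of_one_le_left' hc)
  · rw [min_eq_right h]
    exact min_le_right _ _

variable {d : ℕ} {Ω : Type*} [MeasurableSpace Ω] {P : Measure Ω} [IsProbabilityMeasure P]
  {μ : Measure (EuclideanSpace ℝ (Fin d))} [IsProbabilityMeasure μ] {n : ℕ}
  {X : Fin n → Ω → EuclideanSpace ℝ (Fin d)}

/-- The minimum is kept because both entries are needed later: the first is the only one good at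
high levels and for large `m`, the second carries the decay in `n`. -/
theorem lintegral_cellDiscrepancy_le (hn : 1 ≤ n) (hX : ∀ k, Measurable (X k))
    (hI : iIndepFun X P) (hμ : ∀ k, P.map (X k) = μ) (p : ℝ) {s : ℝ} (hs0 : 0 ≤ s)
    (hs : s ≤ 1 / 2) (l : ℕ) :
    ∫⁻ ω, cellDiscrepancy (cellWeight p) (dyadicCell l) (empiricalMeasure fun k => X k ω) μ ∂P ≤
      ∑' m : ℤ, ENNReal.ofReal ((2 : ℝ) ^ (p * m)) * (2 * 4 ^ d * min (μ {x | 2 ^ m ≤ maxNorm x})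
        (ENNReal.ofReal ((n : ℝ) ^ (-s) * ((2 : ℝ) ^ (d * s)) ^ l) *
          μ {x | 2 ^ m ≤ maxNorm x} ^ (1 - s))) := by
  have hcell : ∀ i, MeasurableSet (dyadicCell (d := d) l ⁻¹' {i}) := fun i =>
    measurable_dyadicCell l (measurableSet_singleton i)
  set e : ℤ × (Fin d → ℤ) → ℝ≥0∞ := fun i =>
    ∫⁻ ω, ((empiricalMeasure (fun k => X k ω) (dyadicCell l ⁻¹' {i}) - μ (dyadicCell l ⁻¹' {i})) +
      (μ (dyadicCell l ⁻¹' {i}) - empiricalMeasure (fun k => X k ω) (dyadicCell l ⁻¹' {i}))) ∂P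
    with he
  have hmeas : ∀ i, Measurable fun ω =>
      ((empiricalMeasure (fun k => X k ω) (dyadicCell l ⁻¹' {i}) - μ (dyadicCell l ⁻¹' {i})) +
      (μ (dyadicCell l ⁻¹' {i}) - empiricalMeasure (fun k => X k ω) (dyadicCell l ⁻¹' {i}))) :=
    fun i => ((measurable_empiricalMeasure_apply hX (hcell i)).sub_const _).add
      ((measurable_empiricalMeasure_apply hX (hcell i)).const_sub _)
  have h1 : ∫⁻ ω, cellDiscrepancy (cellWeight p) (dyadicCell l)
      (empiricalMeasure fun k => X k ω) μ ∂P = ∑' m : ℤ, ∑' j, cellWeight p (m, j) * e (m, j) := by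
    unfold cellDiscrepancy
    rw [lintegral_tsum fun i => ((hmeas i).const_mul _).aemeasurable]
    simp_rw [lintegral_const_mul _ (hmeas _)]
    exact ENNReal.tsum_prod' (f := fun i => cellWeight p i * e i)
  rw [h1]
  refine ENNReal.tsum_le_tsum fun m => ?_
  -- The index `0` has weight zero, and all other indices outside `cubeIndices d l` give empty
  -- cells.
  have h2 : ∑' j, cellWeight p (m, j) * e (m, j) =
      ∑ j ∈ cubeIndices d l, cellWeight p (m, j) * e (m, j) := by
    refine tsum_eq_sum fun j hj => ?_
    rcases eq_or_ne j 0 with rfl | hj0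
    · simp [cellWeight]
    · have : dyadicCell (d := d) l ⁻¹' {(m, j)} = ∅ := by
        rw [Set.eq_empty_iff_forall_notMem]
        exact fun x hx => hj (mem_cubeIndices_of_dyadicCell_eq hj0 hx)
      simp [he, this]
  rw [h2]
  have h3 : ∑ j ∈ cubeIndices d l, cellWeight p (m, j) * e (m, j) ≤
      ENNReal.ofReal ((2 : ℝ) ^ (p * m)) * ∑ j ∈ cubeIndices d l, e (m, j) := by
    rw [Finset.mul_sum]
    refine Finset.sum_le_sum fun j _ => mul_le_mul_left ?_ _
    unfold cellWeight
    split_ifs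
    · exact zero_le
    · exact le_rfl
  refine h3.trans (mul_le_mul_right ?_ _)
  have hsum : ∑ j ∈ cubeIndices d l, μ (dyadicCell l ⁻¹' {(m, j)}) ≤
      μ {x | 2 ^ m ≤ maxNorm x} := by
    rw [← measure_biUnion_finset
      (fun i _ j _ hij => Disjoint.preimage _ (by simpa using hij)) (fun j _ => hcell _)]
    refine measure_mono (iUnion₂_subset fun j hj x hx => ?_)
    exact zpow_le_maxNorm_of_dyadicCell_eq (Finset.ne_of_mem_erase hj) hx
  have hb1 : ∑ j ∈ cubeIndices d l, e (m, j) ≤ 2 * μ {x | 2 ^ m ≤ maxNorm x} := by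
    calc ∑ j ∈ cubeIndices d l, e (m, j)
        ≤ ∑ j ∈ cubeIndices d l, 2 * μ (dyadicCell l ⁻¹' {(m, j)}) :=
          Finset.sum_le_sum fun j _ =>
            lintegral_empirical_discrepancy_le_two_mul hn hX hμ (hcell _)
      _ ≤ _ := by rw [← Finset.mul_sum]; gcongr
  have hb2 : ∑ j ∈ cubeIndices d l, e (m, j) ≤ 2 * (4 ^ d *
      (ENNReal.ofReal ((n : ℝ) ^ (-s) * ((2 : ℝ) ^ (d * s)) ^ l) *
          μ {x | 2 ^ m ≤ maxNorm x} ^ (1 - s))) := by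
    have hcard : ((cubeIndices d l).card : ℝ≥0∞) ^ s ≤
        4 ^ d * ENNReal.ofReal (((2 : ℝ) ^ (d * s)) ^ l) := by
      have c1 : ((cubeIndices d l).card : ℝ≥0∞) ≤ 4 ^ d * (2 ^ d) ^ l := by
        exact_mod_cast card_cubeIndices_le d l
      have c2 : ENNReal.ofReal (((2 : ℝ) ^ (d * s)) ^ l) = ((2 ^ d) ^ l : ℝ≥0∞) ^ s := by
        rw [ENNReal.ofReal_pow (by positivity), ← ENNReal.ofReal_rpow_of_pos two_pos,
          ENNReal.ofReal_ofNat, ENNReal.rpow_mul, ENNReal.rpow_natCast,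
          ← ENNReal.rpow_natCast, ← ENNReal.rpow_mul, mul_comm s, ENNReal.rpow_mul,
          ENNReal.rpow_natCast]
      calc ((cubeIndices d l).card : ℝ≥0∞) ^ s ≤ (4 ^ d * (2 ^ d) ^ l) ^ s := by gcongr
        _ = (4 ^ d) ^ s * ((2 ^ d) ^ l) ^ s := ENNReal.mul_rpow_of_nonneg _ _ hs0
        _ ≤ (4 ^ d) ^ (1 : ℝ) * ((2 ^ d) ^ l) ^ s := by
            gcongr
            · exact one_le_pow₀ (by norm_num)
            · linarith
        _ = _ := by rw [ENNReal.rpow_one, c2]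
    calc ∑ j ∈ cubeIndices d l, e (m, j)
        ≤ ∑ j ∈ cubeIndices d l, 2 * ENNReal.ofReal ((n : ℝ) ^ (-s)) *
            μ (dyadicCell l ⁻¹' {(m, j)}) ^ (1 - s) := Finset.sum_le_sum fun j _ =>
            lintegral_empirical_discrepancy_le_rpow hn hX hI hμ (hcell _) hs0 hs
      _ ≤ 2 * ENNReal.ofReal ((n : ℝ) ^ (-s)) *
          ((4 ^ d * ENNReal.ofReal (((2 : ℝ) ^ (d * s)) ^ l)) *
            μ {x | 2 ^ m ≤ maxNorm x} ^ (1 - s)) := by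
          rw [← Finset.mul_sum]
          refine mul_le_mul_right ((sum_rpow_one_sub_le _ _ hs0 (by linarith)).trans ?_) _
          refine mul_le_mul' hcard (ENNReal.rpow_le_rpow hsum (by linarith))
      _ = _ := by
          rw [ENNReal.ofReal_mul (by positivity)]
          ring
  rw [mul_assoc]
  calc ∑ j ∈ cubeIndices d l, e (m, j) ≤ 2 * min (μ {x | 2 ^ m ≤ maxNorm x}) (4 ^ d *
      (ENNReal.ofReal ((n : ℝ) ^ (-s) * ((2 : ℝ) ^ (d * s)) ^ l) *
          μ {x | 2 ^ m ≤ maxNorm x} ^ (1 - s))) := by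
        rcases min_choice (μ {x | 2 ^ m ≤ maxNorm x}) (4 ^ d *
          (ENNReal.ofReal ((n : ℝ) ^ (-s) * ((2 : ℝ) ^ (d * s)) ^ l) *
            μ {x | 2 ^ m ≤ maxNorm x} ^ (1 - s))) with h | h <;> rw [h]
        · exact hb1
        · exact hb2
    _ ≤ _ := mul_le_mul_right (min_mul_le_mul_min (one_le_pow₀ (by norm_num))) _

/-- A weighted sum over dyadic scales is bounded by an integral of the tail. -/
theorem tsum_scale_le (μ : Measure (EuclideanSpace ℝ (Fin d))) {p : ℝ} (hp : 1 ≤ p)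
    {κ : ℝ≥0∞} (hκ : κ ≠ ∞) {b : ℝ} (hb : 0 ≤ b) (M : ℝ) :
    ∑' m : ℤ, ENNReal.ofReal ((2 : ℝ) ^ (p * m)) *
        min (μ {x | 2 ^ m ≤ maxNorm x}) (κ * μ {x | 2 ^ m ≤ maxNorm x} ^ b) ≤
      ENNReal.ofReal ((2 : ℝ) ^ p) * (tailTerm p μ M + κ * truncatedTerm p b μ M) := by
  set g : ℝ≥0∞ → ℝ≥0∞ := fun h => min h (κ * h ^ b) with hg
  have hgm : Monotone g := fun x y h => by
    simp only [hg]; gcongr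
  set S : ℤ → Set ℝ := fun m => Ico ((2 : ℝ) ^ (m - 1)) (2 ^ m) with hS
  have hSd : Pairwise (Function.onFun Disjoint S) := by
    intro i j hij
    rw [Function.onFun, Set.disjoint_left]
    rintro t ⟨h1, h2⟩ ⟨h3, h4⟩
    have hlt : ∀ a b : ℤ, (2 : ℝ) ^ (a - 1) < 2 ^ b → a ≤ b := fun a b hab => by
      have := (zpow_lt_zpow_iff_right₀ one_lt_two).1 hab
      omega
    exact hij (le_antisymm (hlt i j (h1.trans_lt h4)) (hlt j i (h3.trans_lt h2)))
  -- For `t` in `[2^(m-1), 2^m)` the set `|x| ≥ 2^m` lies in `|x| > t`. The interval has length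
  -- `2^(m-1)` and `t^(p-1) ≥ 2^((m-1)(p-1))` on it, so the loss is exactly `2^p`.
  have step : ∀ m : ℤ, ENNReal.ofReal ((2 : ℝ) ^ (p * m)) * g (μ {x | 2 ^ m ≤ maxNorm x}) ≤
      ENNReal.ofReal ((2 : ℝ) ^ p) *
        ∫⁻ t in S m, ENNReal.ofReal (t ^ (p - 1)) * g (tail μ t) := by
    intro m
    have hpos : (0 : ℝ) < 2 ^ (m - 1) := by positivity
    calc ENNReal.ofReal ((2 : ℝ) ^ (p * m)) * g (μ {x | 2 ^ m ≤ maxNorm x})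
        = ENNReal.ofReal ((2 : ℝ) ^ p) * ∫⁻ _t in S m,
          ENNReal.ofReal (((2 : ℝ) ^ (m - 1)) ^ (p - 1)) * g (μ {x | 2 ^ m ≤ maxNorm x}) := by
          rw [setLIntegral_const, Real.volume_Ico, mul_right_comm, ← mul_assoc,
            ← ENNReal.ofReal_mul (by positivity), ← ENNReal.ofReal_mul (by positivity)]
          congr 2
          have e1 : (2 : ℝ) ^ m - 2 ^ (m - 1) = 2 ^ (m - 1) := by
            conv_lhs => rw [show m = (m - 1) + 1 by ring, zpow_add_one₀ two_ne_zero]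
            ring_nf
          rw [e1, Real.rpow_sub_one hpos.ne', div_mul_cancel₀ _ hpos.ne',
            ← Real.mul_rpow zero_le_two hpos.le, rpow_mul_intCast, ← zpow_one_add₀ two_ne_zero]
          ring_nf
      _ ≤ _ := by
          refine mul_le_mul_right (setLIntegral_mono' measurableSet_Ico fun t ht => ?_) _
          refine mul_le_mul' (ENNReal.ofReal_le_ofReal
            (Real.rpow_le_rpow hpos.le ht.1 (by linarith))) (hgm (measure_mono fun x hx => ?_))
          exact ht.2.trans_le hx
  calc _ ≤ ∑' m : ℤ, ENNReal.ofReal ((2 : ℝ) ^ p) *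
        ∫⁻ t in S m, ENNReal.ofReal (t ^ (p - 1)) * g (tail μ t) := ENNReal.tsum_le_tsum step
    _ = ENNReal.ofReal ((2 : ℝ) ^ p) *
        ∫⁻ t in ⋃ m, S m, ENNReal.ofReal (t ^ (p - 1)) * g (tail μ t) := by
        rw [ENNReal.tsum_mul_left, lintegral_iUnion (fun m => measurableSet_Ico) hSd]
    _ ≤ _ := by
        refine mul_le_mul_right ?_ _
        have hsub : ⋃ m, S m ⊆ Ioc 0 M ∪ Ioi M := by
          refine iUnion_subset fun m t ht => ?_
          rcases le_or_gt t M with h | h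
          · exact Or.inl ⟨(by positivity : (0 : ℝ) < 2 ^ (m - 1)).trans_le ht.1, h⟩
          · exact Or.inr h
        refine (lintegral_mono_set hsub).trans ((lintegral_union_le _ _ _).trans ?_)
        rw [add_comm]
        refine add_le_add ?_ ?_
        · exact lintegral_mono fun t => mul_le_mul_right (min_le_left _ _) _
        · rw [truncatedTerm, ← lintegral_const_mul' _ _ hκ]
          refine lintegral_mono fun t => ?_
          rw [mul_left_comm]
          exact mul_le_mul_right (min_le_right _ _) _

theorem strongMoment_empiricalMeasure_lt_top {p : ℝ} (hn : 1 ≤ n)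
    (x : Fin n → EuclideanSpace ℝ (Fin d)) : strongMoment p (empiricalMeasure x) < ∞ := by
  rw [strongMoment, lintegral_empiricalMeasure _ (by
    have := measurable_maxNorm (d := d); fun_prop)]
  refine ENNReal.mul_lt_top ?_ ?_
  · simp; omega
  · exact ENNReal.sum_lt_top.2 fun _ _ => ENNReal.ofReal_lt_top

/-- The moment bound for the empirical measure, given a bound of the sum over the levels. -/
theorem lintegral_wassersteinPow_empiricalMeasure_le (hn : 1 ≤ n) (hX : ∀ k, Measurable (X k))
    (hI : iIndepFun X P) (hμ : ∀ k, P.map (X k) = μ) {p : ℝ} (hp : 1 ≤ p) {s : ℝ} (hs0 : 0 ≤ s)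
    (hs : s ≤ 1 / 2) {κ C : ℝ≥0∞} (hκ : κ ≠ ∞) {b : ℝ} (hb : 0 ≤ b)
    (hC : ∀ h ≤ 1, ∑' l : ℕ, ENNReal.ofReal (((2 : ℝ) ^ (-p)) ^ l) *
      min h (ENNReal.ofReal ((n : ℝ) ^ (-s) * ((2 : ℝ) ^ (d * s)) ^ l) * h ^ (1 - s)) ≤
        C * min h (κ * h ^ b)) (M : ℝ) :
    ∫⁻ ω, wassersteinPow p (empiricalMeasure fun k => X k ω) μ ∂P ≤
      ENNReal.ofReal ((4 * d) ^ p) * (2 * 4 ^ d) * C * ENNReal.ofReal ((2 : ℝ) ^ p) *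
        (tailTerm p μ M + κ * truncatedTerm p b μ M) := by
  have hprob := fun ω => isProbabilityMeasure_empiricalMeasure hn (fun k => X k ω)
  have hmeas : ∀ l, Measurable fun ω => cellDiscrepancy (cellWeight p) (dyadicCell l)
      (empiricalMeasure fun k => X k ω) μ := fun l => by
    unfold cellDiscrepancy
    refine Measurable.tsum fun i => Measurable.const_mul ?_ _
    have hc : MeasurableSet (dyadicCell (d := d) l ⁻¹' {i}) :=
      measurable_dyadicCell l (measurableSet_singleton i)
    exact ((measurable_empiricalMeasure_apply hX hc).sub_const _).add
      ((measurable_empiricalMeasure_apply hX hc).const_sub _)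
  set h : ℤ → ℝ≥0∞ := fun m => μ {x | 2 ^ m ≤ maxNorm x} with hh
  calc _ ≤ ∫⁻ ω, ENNReal.ofReal ((4 * d) ^ p) * ∑' l : ℕ, ENNReal.ofReal (((2 : ℝ) ^ (-p)) ^ l) *
        cellDiscrepancy (cellWeight p) (dyadicCell l) (empiricalMeasure fun k => X k ω) μ ∂P :=
        -- The moment condition falls on the first measure, here the empirical one, whose moments
        -- are always finite.
        lintegral_mono fun ω => wassersteinPow_le_tsum_cellDiscrepancy hp _ _
          (strongMoment_empiricalMeasure_lt_top hn _)
    _ = ENNReal.ofReal ((4 * d) ^ p) * ∑' l : ℕ, ENNReal.ofReal (((2 : ℝ) ^ (-p)) ^ l) *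
        ∫⁻ ω, cellDiscrepancy (cellWeight p) (dyadicCell l)
          (empiricalMeasure fun k => X k ω) μ ∂P := by
        rw [lintegral_const_mul _ (Measurable.tsum fun l => (hmeas l).const_mul _),
          lintegral_tsum fun l => ((hmeas l).const_mul _).aemeasurable]
        simp_rw [lintegral_const_mul _ (hmeas _)]
    _ ≤ ENNReal.ofReal ((4 * d) ^ p) * ∑' l : ℕ, ENNReal.ofReal (((2 : ℝ) ^ (-p)) ^ l) *
        ∑' m : ℤ, ENNReal.ofReal ((2 : ℝ) ^ (p * m)) * (2 * 4 ^ d * min (h m)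
          (ENNReal.ofReal ((n : ℝ) ^ (-s) * ((2 : ℝ) ^ (d * s)) ^ l) * h m ^ (1 - s))) := by
        refine mul_le_mul_right (ENNReal.tsum_le_tsum fun l => mul_le_mul_right ?_ _) _
        exact lintegral_cellDiscrepancy_le hn hX hI hμ p hs0 hs l
    _ = ENNReal.ofReal ((4 * d) ^ p) * (2 * 4 ^ d) * ∑' m : ℤ, ENNReal.ofReal ((2 : ℝ) ^ (p * m)) *
        ∑' l : ℕ, ENNReal.ofReal (((2 : ℝ) ^ (-p)) ^ l) * min (h m)
          (ENNReal.ofReal ((n : ℝ) ^ (-s) * ((2 : ℝ) ^ (d * s)) ^ l) * h m ^ (1 - s)) := by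
        simp_rw [mul_assoc (ENNReal.ofReal ((4 * (d : ℝ)) ^ p)), ← ENNReal.tsum_mul_left]
        rw [ENNReal.tsum_comm]
        refine tsum_congr fun m => tsum_congr fun l => ?_
        ring
    _ ≤ ENNReal.ofReal ((4 * d) ^ p) * (2 * 4 ^ d) * ∑' m : ℤ, ENNReal.ofReal ((2 : ℝ) ^ (p * m)) *
        (C * min (h m) (κ * h m ^ b)) := by
        refine mul_le_mul_right (ENNReal.tsum_le_tsum fun m => mul_le_mul_right ?_ _) _
        exact hC _ prob_le_one
    _ = ENNReal.ofReal ((4 * d) ^ p) * (2 * 4 ^ d) * C *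
        ∑' m : ℤ, ENNReal.ofReal ((2 : ℝ) ^ (p * m)) * min (h m) (κ * h m ^ b) := by
        simp_rw [mul_left_comm _ C, ENNReal.tsum_mul_left, mul_assoc]
    _ ≤ _ := by
        rw [mul_assoc _ (ENNReal.ofReal ((2 : ℝ) ^ p))]
        exact mul_le_mul_right (tsum_scale_le μ hp hκ hb M) _

end Expectation

/-! ### Measurability of the Wasserstein cost in the sample. -/

section Measurability

/-- The decompositions of `μ` into `n` measures of the same mass `1/n`. -/
def equalDecompositions {E : Type*} [MeasurableSpace E] (n : ℕ) (μ : Measure E) :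
    Set (Fin n → Measure E) :=
  {ν | ∑ k, ν k = μ ∧ ∀ k, ν k univ = (n : ℝ≥0∞)⁻¹}

variable {d n : ℕ} {μ : Measure (EuclideanSpace ℝ (Fin d))} [IsProbabilityMeasure μ]

/-- A coupling with the empirical measure prescribes where the mass `1/n` at each sample point goes.
The set of the infimum no longer depends on `x`. -/
theorem wassersteinPow_empiricalMeasure_eq (hn : 1 ≤ n) (p : ℝ)
    (x : Fin n → EuclideanSpace ℝ (Fin d)) :
    wassersteinPow p (empiricalMeasure x) μ =
      ⨅ ν ∈ equalDecompositions n μ, ∑ k, ∫⁻ y, edist (x k) y ^ p ∂(ν k) := by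
  have hc : Measurable fun z : EuclideanSpace ℝ (Fin d) × EuclideanSpace ℝ (Fin d) =>
      edist z.1 z.2 ^ p := by fun_prop
  have hprob := isProbabilityMeasure_empiricalMeasure hn x
  apply le_antisymm
  · refine le_iInf₂ fun ν ⟨hν, hmass⟩ => ?_
    have hfin : ∀ k, IsFiniteMeasure (ν k) := fun k => ⟨by
      rw [hmass]; simp; omega⟩
    have h1 : (∑ k, (Measure.dirac (x k)).prod (ν k)).map Prod.fst = empiricalMeasure x := by
      rw [← Measure.sum_fintype, Measure.map_sum measurable_fst.aemeasurable, Measure.sum_fintype,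
        empiricalMeasure, Finset.smul_sum]
      exact Finset.sum_congr rfl fun k _ => by rw [Measure.map_fst_prod, hmass]
    have h2 : (∑ k, (Measure.dirac (x k)).prod (ν k)).map Prod.snd = μ := by
      rw [← Measure.sum_fintype, Measure.map_sum measurable_snd.aemeasurable, Measure.sum_fintype,
        ← hν]
      exact Finset.sum_congr rfl fun k _ => by
        rw [Measure.map_snd_prod, measure_univ, one_smul]
    have hmem : ∑ k, (Measure.dirac (x k)).prod (ν k) ∈ couplings (empiricalMeasure x) μ := by
      refine ⟨⟨?_⟩, h1, h2⟩
      rw [← measure_univ (μ := μ), ← h2, Measure.map_apply measurable_snd .univ, preimage_univ]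
    refine (iInf₂_le _ hmem).trans_eq ?_
    rw [lintegral_finsetSum_measure]
    refine Finset.sum_congr rfl fun k _ => ?_
    rw [lintegral_prod _ hc.aemeasurable, lintegral_dirac' _ hc.lintegral_prod_right']
  · refine le_iInf₂ fun π ⟨hπ, h1, h2⟩ => ?_
    -- Disintegrate over the first margin and let `ν k` be `1/n` times the kernel at `x k`. Repeated
    -- sample points share the same kernel value, so they do no harm.
    obtain ⟨κ, _, hdis⟩ : ∃ κ : Kernel (EuclideanSpace ℝ (Fin d)) (EuclideanSpace ℝ (Fin d)),
        IsMarkovKernel κ ∧ empiricalMeasure x ⊗ₘ κ = π :=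
      ⟨π.condKernel, inferInstance, by rw [← h1]; exact π.disintegrate π.condKernel⟩
    have hmem : (fun k => (n : ℝ≥0∞)⁻¹ • κ (x k)) ∈ equalDecompositions n μ := by
      refine ⟨?_, fun k => by simp⟩
      ext A hA
      rw [← h2, ← hdis, Measure.map_apply measurable_snd hA,
        Measure.compProd_apply (measurable_snd hA), lintegral_empiricalMeasure _
        (Kernel.measurable_kernel_prodMk_left (measurable_snd hA)), Finset.mul_sum]
      simp only [Measure.coe_finsetSum, Finset.sum_apply, Measure.smul_apply, smul_eq_mul]
      rfl
    refine (iInf₂_le _ hmem).trans_eq ?_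
    rw [← hdis, Measure.lintegral_compProd hc, lintegral_empiricalMeasure _
      (Measurable.lintegral_kernel_prod_right' hc), Finset.mul_sum]
    simp only [lintegral_smul_measure, smul_eq_mul]

theorem lintegral_edist_rpow_lt_top {p : ℝ} (hp : 1 ≤ p) (hμ : strongMoment p μ < ∞)
    (x : EuclideanSpace ℝ (Fin d)) : ∫⁻ y, (1 + edist x y) ^ p ∂μ < ∞ := by
  have hp0 : 0 ≤ p := by linarith
  have h : ∀ y : EuclideanSpace ℝ (Fin d), (1 + edist x y) ^ p ≤
      2 ^ (p - 1) * ((1 + edist x 0) ^ p +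
        ENNReal.ofReal ((d : ℝ) ^ p) * ENNReal.ofReal (maxNorm y ^ p)) := by
    intro y
    calc (1 + edist x y) ^ p ≤ ((1 + edist x 0) + edist 0 y) ^ p := by
          rw [add_assoc]
          gcongr
          exact edist_triangle _ _ _
      _ ≤ 2 ^ (p - 1) * ((1 + edist x 0) ^ p + edist 0 y ^ p) :=
          ENNReal.rpow_add_le_mul_rpow_add_rpow _ _ hp
      _ ≤ _ := by
          gcongr
          rw [← ENNReal.ofReal_mul (by positivity),
            ← Real.mul_rpow (by positivity) (maxNorm_nonneg y)]
          refine edist_rpow_le_ofReal hp0 ?_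
          rw [dist_zero_left]
          exact norm_le_mul_maxNorm y
  refine (lintegral_mono h).trans_lt ?_
  rw [lintegral_const_mul' _ _ (ENNReal.rpow_ne_top_of_nonneg (by linarith) (by simp)),
    lintegral_add_left measurable_const, lintegral_const_mul' _ _ ENNReal.ofReal_ne_top]
  refine ENNReal.mul_lt_top (ENNReal.rpow_lt_top_of_nonneg (by linarith) (by simp))
    (ENNReal.add_lt_top.2 ⟨?_, ENNReal.mul_lt_top ENNReal.ofReal_lt_top hμ⟩)
  rw [lintegral_const, measure_univ, mul_one]
  exact ENNReal.rpow_lt_top_of_nonneg hp0 (by finiteness)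

/-- Dominated convergence: on the unit ball around `x` the integrand is at most `(1 + edist x y) ^
p`. -/
theorem continuous_lintegral_edist_rpow {p : ℝ} (hp : 1 ≤ p) (hμ : strongMoment p μ < ∞)
    {ν : Measure (EuclideanSpace ℝ (Fin d))} (hν : ν ≤ μ) :
    Continuous fun x => ∫⁻ y, edist x y ^ p ∂ν := by
  have hp0 : 0 ≤ p := by linarith
  rw [continuous_iff_continuousAt]
  intro x
  refine tendsto_lintegral_filter_of_dominated_convergence (fun y => (1 + edist x y) ^ p)
    (.of_forall fun z => by fun_prop) ?_
    ((lintegral_mono' hν le_rfl).trans_lt (lintegral_edist_rpow_lt_top hp hμ x)).ne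
    (.of_forall fun y => ?_)
  · filter_upwards [Metric.eball_mem_nhds x one_pos] with z hz
    refine .of_forall fun y => ?_
    gcongr
    refine (edist_triangle z x y).trans ?_
    gcongr
    exact (Metric.mem_eball.1 hz).le
  · exact (ENNReal.continuous_rpow_const.comp (by fun_prop :
      Continuous fun z => edist z y)).tendsto x

theorem measurable_wassersteinPow_empiricalMeasure {p : ℝ} (hp : 1 ≤ p) (hn : 1 ≤ n)
    (hμ : strongMoment p μ < ∞) :
    Measurable fun x : Fin n → EuclideanSpace ℝ (Fin d) =>
      wassersteinPow p (empiricalMeasure x) μ := by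
  simp_rw [wassersteinPow_empiricalMeasure_eq hn]
  refine UpperSemicontinuous.measurable (upperSemicontinuous_biInf fun ν hν => ?_)
  refine Continuous.upperSemicontinuous (continuous_finsetSum _ fun k _ => ?_)
  have hle : ν k ≤ μ := by
    rw [← hν.1]
    exact Finset.single_le_sum (f := ν) (fun _ _ => Measure.zero_le _) (Finset.mem_univ k)
  exact (continuous_lintegral_edist_rpow hp hμ hle).comp (continuous_apply k)

end Measurability

/-! ### Summation over the levels in the three regimes. -/

section LevelSums

theorem sum_range_pow_le {x : ℝ} (hx0 : 0 ≤ x) (hx1 : x < 1) (L : ℕ) :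
    ∑ l ∈ Finset.range L, x ^ l ≤ (1 - x)⁻¹ := by
  rw [← tsum_geometric_of_lt_one hx0 hx1]
  exact (summable_geometric_of_lt_one hx0 hx1).sum_le_tsum _ fun _ _ => by positivity

/-- Cut the sum at an arbitrary level `K`, using the growing entry of the minimum below it and the
constant one above. With `K = 0` this is the trivial bound `a / (1 - x)`. -/
theorem sum_range_pow_mul_min_le {x y a t : ℝ} (hx0 : 0 ≤ x) (hx1 : x < 1) (hy : 0 ≤ y)
    (ha : 0 ≤ a) (ht : 0 ≤ t) (K L : ℕ) :
    ∑ l ∈ Finset.range L, x ^ l * min a (t * y ^ l) ≤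
      t * ∑ l ∈ Finset.range K, (x * y) ^ l + a * (x ^ K * (1 - x)⁻¹) := by
  have hnn : ∀ l, 0 ≤ x ^ l * min a (t * y ^ l) := fun l => by positivity
  calc ∑ l ∈ Finset.range L, x ^ l * min a (t * y ^ l)
      ≤ ∑ l ∈ Finset.range (K + L), x ^ l * min a (t * y ^ l) :=
        Finset.sum_le_sum_of_subset_of_nonneg (Finset.range_mono (by omega)) fun l _ _ => hnn l
    _ = ∑ l ∈ Finset.range K, x ^ l * min a (t * y ^ l) +
        ∑ l ∈ Finset.range L, x ^ (K + l) * min a (t * y ^ (K + l)) :=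
        Finset.sum_range_add _ _ _
    _ ≤ ∑ l ∈ Finset.range K, x ^ l * (t * y ^ l) + ∑ l ∈ Finset.range L, x ^ (K + l) * a := by
        gcongr
        · exact min_le_right _ _
        · exact min_le_left _ _
    _ = t * ∑ l ∈ Finset.range K, (x * y) ^ l + a * (x ^ K * ∑ l ∈ Finset.range L, x ^ l) := by
        simp_rw [Finset.mul_sum, mul_pow, pow_add]
        congr 1
        · exact Finset.sum_congr rfl fun _ _ => by ring
        · exact Finset.sum_congr rfl fun _ _ => by ring
    _ ≤ _ := by
        gcongr
        exact sum_range_pow_le hx0 hx1 L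

/-- Passing from a bound of finite sums of reals to the sum over all levels. -/
theorem tsum_level_le_of_real {x y N s κ b C : ℝ} (hx0 : 0 ≤ x) (hy : 0 ≤ y) (hN : 0 ≤ N)
    (hκ : 0 ≤ κ) (hC : 0 ≤ C)
    (H : ∀ m : ℝ, 0 < m → m ≤ 1 → ∀ L : ℕ,
      ∑ l ∈ Finset.range L, x ^ l * min m (N ^ (-s) * m ^ (1 - s) * y ^ l) ≤ C * m ∧
      ∑ l ∈ Finset.range L, x ^ l * min m (N ^ (-s) * m ^ (1 - s) * y ^ l) ≤ C * (κ * m ^ b))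
    (h : ℝ≥0∞) (hh : h ≤ 1) :
    ∑' l : ℕ, ENNReal.ofReal (x ^ l) *
      min h (ENNReal.ofReal (N ^ (-s) * y ^ l) * h ^ (1 - s)) ≤
        ENNReal.ofReal C * min h (ENNReal.ofReal κ * h ^ b) := by
  rcases eq_or_ne h 0 with rfl | h0
  · simp
  have hfin : h ≠ ∞ := ne_top_of_le_ne_top ENNReal.one_ne_top hh
  obtain ⟨m, hm, rfl⟩ : ∃ m : ℝ, 0 < m ∧ h = ENNReal.ofReal m :=
    ⟨h.toReal, ENNReal.toReal_pos h0 hfin, (ENNReal.ofReal_toReal hfin).symm⟩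
  have hm1 : m ≤ 1 := by simpa using hh
  have e : ∀ l : ℕ, ENNReal.ofReal (x ^ l) *
      min (ENNReal.ofReal m) (ENNReal.ofReal (N ^ (-s) * y ^ l) * ENNReal.ofReal m ^ (1 - s)) =
      ENNReal.ofReal (x ^ l * min m (N ^ (-s) * m ^ (1 - s) * y ^ l)) := by
    intro l
    rw [ENNReal.ofReal_rpow_of_pos hm, ← ENNReal.ofReal_mul (by positivity), ← ENNReal.ofReal_min,
      ← ENNReal.ofReal_mul (by positivity), mul_right_comm]
  simp_rw [e]
  refine ENNReal.tsum_le_of_sum_range_le fun L => ?_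
  rw [← ENNReal.ofReal_sum_of_nonneg fun l _ => by positivity, ENNReal.ofReal_rpow_of_pos hm,
    ← ENNReal.ofReal_mul hκ, ← ENNReal.ofReal_min, ← ENNReal.ofReal_mul hC]
  refine ENNReal.ofReal_le_ofReal ?_
  rcases min_choice m (κ * m ^ b) with h | h <;> rw [h]
  · exact (H m hm hm1 L).1
  · exact (H m hm hm1 L).2

theorem rpow_neg_mul_rpow_one_sub {N m : ℝ} (hN : 0 < N) (hm : 0 < m) (s : ℝ) :
    N ^ (-s) * m ^ (1 - s) = m * (N * m) ^ (-s) := by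
  rw [Real.mul_rpow hN.le hm.le, sub_eq_add_neg, Real.rpow_add hm, Real.rpow_one]; ring

variable {d : ℕ} {p s : ℝ}

/-- Here `x * y < 1`, so the growing entry of the minimum is itself summable and no cut is needed.
-/
theorem exists_level_bound_of_gt (hp : 1 ≤ p)
    (hds : d * s < p) : ∃ C : ℝ, 0 < C ∧ ∀ n : ℕ, 1 ≤ n → ∀ h ≤ 1,
      ∑' l : ℕ, ENNReal.ofReal (((2 : ℝ) ^ (-p)) ^ l) *
      min h (ENNReal.ofReal ((n : ℝ) ^ (-s) * ((2 : ℝ) ^ (d * s)) ^ l) * h ^ (1 - s)) ≤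
        ENNReal.ofReal C * min h (ENNReal.ofReal (1 / (n : ℝ) ^ s) * h ^ (1 - s)) := by
  set x : ℝ := 2 ^ (-p) with hx
  set y : ℝ := 2 ^ (d * s) with hy
  have hx1 : x < 1 := Real.rpow_lt_one_of_one_lt_of_neg one_lt_two (by linarith)
  have hx0 : 0 < x := by positivity
  have hxy : x * y < 1 := by
    rw [hx, hy, ← Real.rpow_add two_pos]
    exact Real.rpow_lt_one_of_one_lt_of_neg one_lt_two (by linarith)
  have hxy0 : 0 < x * y := by positivity
  have c1 : 0 < (1 - x)⁻¹ := inv_pos.2 (by linarith)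
  have c2 : 0 < (1 - x * y)⁻¹ := inv_pos.2 (by linarith)
  refine ⟨(1 - x)⁻¹ + (1 - x * y)⁻¹, by positivity, fun n hn => ?_⟩
  refine tsum_level_le_of_real hx0.le (by positivity) (by positivity) (by positivity)
    (by positivity) fun m hm hm1 L => ⟨?_, ?_⟩
  · calc _ ≤ _ := sum_range_pow_mul_min_le hx0.le hx1 (by positivity) hm.le (by positivity) 0 L
      _ = (1 - x)⁻¹ * m := by simp [mul_comm]
      _ ≤ _ := by gcongr; linarith
  · calc ∑ l ∈ Finset.range L, x ^ l * min m ((n : ℝ) ^ (-s) * m ^ (1 - s) * y ^ l)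
        ≤ ∑ l ∈ Finset.range L, x ^ l * ((n : ℝ) ^ (-s) * m ^ (1 - s) * y ^ l) := by
          gcongr; exact min_le_right _ _
      _ = (n : ℝ) ^ (-s) * m ^ (1 - s) * ∑ l ∈ Finset.range L, (x * y) ^ l := by
          rw [Finset.mul_sum]
          exact Finset.sum_congr rfl fun _ _ => by rw [mul_pow]; ring
      _ ≤ (n : ℝ) ^ (-s) * m ^ (1 - s) * ((1 - x)⁻¹ + (1 - x * y)⁻¹) := by
          gcongr
          linarith [sum_range_pow_le hxy0.le hxy L]
      _ = _ := by
          rw [Real.rpow_neg (by positivity)]; ring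

/-- Here `x * y = 1`: every level below the cut contributes the same amount, and their number gives
the logarithm. -/
theorem exists_level_bound_of_eq (hp : 1 ≤ p) (hs0 : 0 ≤ s) (hs : s < 1)
    (hds : p = d * s) : ∃ C : ℝ, 0 < C ∧ ∀ n : ℕ, 2 ≤ n → ∀ h ≤ 1,
      ∑' l : ℕ, ENNReal.ofReal (((2 : ℝ) ^ (-p)) ^ l) *
      min h (ENNReal.ofReal ((n : ℝ) ^ (-s) * ((2 : ℝ) ^ (d * s)) ^ l) * h ^ (1 - s)) ≤
        ENNReal.ofReal C * min h (ENNReal.ofReal (Real.log n / (n : ℝ) ^ s) * h ^ (1 - s)) := by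
  set x : ℝ := 2 ^ (-p) with hx
  set y : ℝ := 2 ^ (d * s) with hy
  have hx1 : x < 1 := Real.rpow_lt_one_of_one_lt_of_neg one_lt_two (by linarith)
  have hx0 : 0 < x := by positivity
  have hxy : x * y = 1 := by
    rw [hx, hy, ← Real.rpow_add two_pos, hds, neg_add_cancel, Real.rpow_zero]
  have c1 : 0 < (1 - x)⁻¹ := inv_pos.2 (by linarith)
  have hl2 : 0 < Real.log 2 := Real.log_pos one_lt_two
  refine ⟨(1 - x)⁻¹ + (2 + (1 - x)⁻¹) / Real.log 2, by positivity, fun n hn => ?_⟩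
  have hn1 : (1 : ℝ) < n := by exact_mod_cast hn
  have hlog : 0 < Real.log n := Real.log_pos hn1
  refine tsum_level_le_of_real hx0.le (by positivity) (by positivity) (by positivity)
    (by positivity) fun m hm hm1 L => ⟨?_, ?_⟩
  · calc _ ≤ _ := sum_range_pow_mul_min_le hx0.le hx1 (by positivity) hm.le (by positivity) 0 L
      _ = (1 - x)⁻¹ * m := by simp [mul_comm]
      _ ≤ _ := by
          gcongr
          have : 0 < (2 + (1 - x)⁻¹) / Real.log 2 := by positivity
          linarith
  -- The cut is at `2^(k+1)`, the first power of two beyond `n`. The levels above it contribute at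
  -- most a multiple of `n^(-p) ≤ n^(-s)`, as `s < 1 ≤ p`.
  · obtain ⟨k, hk1, hk2⟩ := exists_nat_pow_near hn1.le one_lt_two
    have hlog2 : Real.log 2 ≤ Real.log n :=
      Real.log_le_log two_pos (by exact_mod_cast hn)
    have hk : ((k + 1 : ℕ) : ℝ) ≤ 2 / Real.log 2 * Real.log n := by
      have : k * Real.log 2 ≤ Real.log n := by
        rw [← Real.log_pow]; exact Real.log_le_log (by positivity) hk1
      rw [div_mul_eq_mul_div, le_div_iff₀ hl2]
      push_cast
      linarith
    have hxk : x ^ (k + 1) ≤ (n : ℝ) ^ (-s) := by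
      calc x ^ (k + 1) = ((2 : ℝ) ^ (k + 1)) ^ (-p) := by
            rw [hx, ← Real.rpow_mul_natCast zero_le_two, mul_comm,
              Real.rpow_natCast_mul zero_le_two]
        _ ≤ (n : ℝ) ^ (-p) := Real.rpow_le_rpow_of_nonpos (by positivity) hk2.le (by linarith)
        _ ≤ _ := Real.rpow_le_rpow_of_exponent_le hn1.le (by linarith)
    have hmm : m ≤ m ^ (1 - s) := by
      conv_lhs => rw [← Real.rpow_one m]
      exact Real.rpow_le_rpow_of_exponent_ge hm hm1 (by linarith)
    calc _ ≤ _ := sum_range_pow_mul_min_le hx0.le hx1 (by positivity) hm.le (by positivity)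
          (k + 1) L
      _ = (n : ℝ) ^ (-s) * m ^ (1 - s) * ((k + 1 : ℕ) : ℝ) + m * (x ^ (k + 1) * (1 - x)⁻¹) := by
          simp [hxy]
      _ ≤ (n : ℝ) ^ (-s) * m ^ (1 - s) * (2 / Real.log 2 * Real.log n) +
          m ^ (1 - s) * ((n : ℝ) ^ (-s) * ((1 - x)⁻¹ * (Real.log n / Real.log 2))) := by
          gcongr
          exact le_mul_of_one_le_right c1.le ((one_le_div hl2).2 hlog2)
      _ = (2 + (1 - x)⁻¹) / Real.log 2 * (Real.log n / (n : ℝ) ^ s * m ^ (1 - s)) := by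
          rw [Real.rpow_neg (by positivity)]; ring
      _ ≤ _ := by gcongr; linarith

/-- Here `x * y > 1`: the sum is dominated by the levels near the one where the two entries of the
minimum cross, so the rate depends on `p / d` and no longer on `s`. -/
theorem exists_level_bound_of_lt (hd : 1 ≤ d) (hp : 1 ≤ p)
    (hds : p < d * s) : ∃ C : ℝ, 0 < C ∧ ∀ n : ℕ, 1 ≤ n → ∀ h ≤ 1,
      ∑' l : ℕ, ENNReal.ofReal (((2 : ℝ) ^ (-p)) ^ l) *
      min h (ENNReal.ofReal ((n : ℝ) ^ (-s) * ((2 : ℝ) ^ (d * s)) ^ l) * h ^ (1 - s)) ≤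
        ENNReal.ofReal C *
          min h (ENNReal.ofReal (1 / (n : ℝ) ^ (p / d)) * h ^ ((d - p) / d)) := by
  set x : ℝ := 2 ^ (-p) with hx
  set y : ℝ := 2 ^ (d * s) with hy
  have hd0 : (0 : ℝ) < d := by exact_mod_cast hd
  have hx1 : x < 1 := Real.rpow_lt_one_of_one_lt_of_neg one_lt_two (by linarith)
  have hx0 : 0 < x := by positivity
  have hxy2 : x * y = 2 ^ (d * s - p) := by
    rw [hx, hy, ← Real.rpow_add two_pos]; ring_nf
  have hxy : 1 < x * y := by
    rw [hxy2]; exact Real.one_lt_rpow one_lt_two (by linarith)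
  have c1 : 0 < (1 - x)⁻¹ := inv_pos.2 (by linarith)
  have c2 : 0 < (x * y - 1)⁻¹ := inv_pos.2 (by linarith)
  have hc : (d - p) / d = 1 - p / d := by field_simp
  refine ⟨(1 - x)⁻¹ + x * y * (x * y - 1)⁻¹, by positivity, fun n hn => ?_⟩
  have hn0 : (0 : ℝ) < n := by exact_mod_cast hn
  refine tsum_level_le_of_real hx0.le (by positivity) (by positivity) (by positivity)
    (by positivity) fun m hm hm1 L => ?_
  have first : ∑ l ∈ Finset.range L, x ^ l * min m ((n : ℝ) ^ (-s) * m ^ (1 - s) * y ^ l) ≤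
      ((1 - x)⁻¹ + x * y * (x * y - 1)⁻¹) * m := by
    calc _ ≤ _ := sum_range_pow_mul_min_le hx0.le hx1 (by positivity) hm.le (by positivity) 0 L
      _ = (1 - x)⁻¹ * m := by simp [mul_comm]
      _ ≤ _ := by
          gcongr
          have : 0 < x * y * (x * y - 1)⁻¹ := by positivity
          linarith
  refine ⟨first, ?_⟩
  have target : 1 / (n : ℝ) ^ (p / d) * m ^ ((d - p) / d) = m * (n * m) ^ (-(p / d)) := by
    rw [← rpow_neg_mul_rpow_one_sub hn0 hm, hc, Real.rpow_neg hn0.le, one_div]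
  rw [target]
  have hN : 0 < n * m := by positivity
  have hpd : 0 < p / d := by positivity
  rcases le_total (n * m) 1 with h | h
  · refine first.trans ?_
    gcongr
    exact le_mul_of_one_le_right hm.le
      (Real.one_le_rpow_of_pos_of_le_one_of_nonpos hN h (by linarith))
  -- The entries `m` and `n^(-s) m^(1-s) 2^(dsl)` coincide when `2^l = (n m)^(1/d)`; the sum is cut
  -- there.
  · set u : ℝ := (n * m) ^ (1 / d : ℝ) with hu
    have hu1 : 1 ≤ u := Real.one_le_rpow h (by positivity)
    have hu0 : 0 < u := by positivity
    have huN : ∀ a : ℝ, u ^ a = (n * m) ^ (a / d) := fun a => by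
      rw [hu, ← Real.rpow_mul hN.le]; congr 1; ring
    obtain ⟨k, hk1, hk2⟩ := exists_nat_pow_near hu1 one_lt_two
    have e1 : x ^ (k + 1) ≤ (n * m) ^ (-(p / d)) := by
      calc x ^ (k + 1) = ((2 : ℝ) ^ (k + 1)) ^ (-p) := by
            rw [hx, ← Real.rpow_mul_natCast zero_le_two, mul_comm,
              Real.rpow_natCast_mul zero_le_two]
        _ ≤ u ^ (-p) := Real.rpow_le_rpow_of_nonpos (by positivity) hk2.le (by linarith)
        _ = _ := by rw [huN, neg_div]
    have e2 : (n * m) ^ (-s) * (x * y) ^ (k + 1) ≤ x * y * (n * m) ^ (-(p / d)) := by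
      calc (n * m) ^ (-s) * (x * y) ^ (k + 1)
          = (n * m) ^ (-s) * (x * y * ((2 : ℝ) ^ k) ^ (d * s - p)) := by
            rw [pow_succ']
            congr 2
            rw [hxy2, ← Real.rpow_mul_natCast zero_le_two, mul_comm,
              Real.rpow_natCast_mul zero_le_two]
        _ ≤ (n * m) ^ (-s) * (x * y * u ^ (d * s - p)) := by
            gcongr
        _ = x * y * ((n * m) ^ (-s) * (n * m) ^ ((d * s - p) / d)) := by rw [huN]; ring
        _ = _ := by
            rw [← Real.rpow_add hN]
            congr 2
            field_simp
            ring
    calc _ ≤ _ := sum_range_pow_mul_min_le hx0.le hx1 (by positivity) hm.le (by positivity)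
          (k + 1) L
      _ = m * (n * m) ^ (-s) * (((x * y) ^ (k + 1) - 1) * (x * y - 1)⁻¹) +
          m * (x ^ (k + 1) * (1 - x)⁻¹) := by
          rw [geom_sum_eq hxy.ne', rpow_neg_mul_rpow_one_sub hn0 hm, div_eq_mul_inv]
      _ ≤ m * (n * m) ^ (-s) * ((x * y) ^ (k + 1) * (x * y - 1)⁻¹) +
          m * ((n * m) ^ (-(p / d)) * (1 - x)⁻¹) := by
          gcongr
          linarith
      _ = m * (((n * m) ^ (-s) * (x * y) ^ (k + 1)) * (x * y - 1)⁻¹) +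
          m * ((n * m) ^ (-(p / d)) * (1 - x)⁻¹) := by ring
      _ ≤ m * ((x * y * (n * m) ^ (-(p / d))) * (x * y - 1)⁻¹) +
          m * ((n * m) ^ (-(p / d)) * (1 - x)⁻¹) := by gcongr
      _ = _ := by ring

end LevelSums

/-! ### Assembly of the three regimes. -/

theorem theorem5p1 (d : ℕ) (hd : 1 ≤ d) (p : ℝ) (hp : 1 ≤ p) (q : ℝ) (hq1 : 1 < q) (hq2 : q ≤ 2) :
    ∃ C : ℝ≥0, 0 < C ∧
      ∀ {Ω : Type*} [MeasurableSpace Ω] (P : Measure Ω) [IsProbabilityMeasure P]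
        (μ : Measure (EuclideanSpace ℝ (Fin d))) [IsProbabilityMeasure μ]
        (n : ℕ) (X : Fin n → Ω → EuclideanSpace ℝ (Fin d)),
        1 ≤ n → (∀ k, Measurable (X k)) → iIndepFun X P → (∀ k, P.map (X k) = μ) →
        strongMoment p μ < ∞ →
        Measurable (fun ω => wassersteinPow p (empiricalMeasure fun k => X k ω) μ) ∧
        ∀ M : ℝ, 0 < M →
          (d * (q - 1) / q < p →
            ∫⁻ ω, wassersteinPow p (empiricalMeasure fun k => X k ω) μ ∂P ≤
              C * (tailTerm p μ M +
                ENNReal.ofReal (1 / (n : ℝ) ^ ((q - 1) / q)) * truncatedTerm p (1 / q) μ M)) ∧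
          (p = d * (q - 1) / q → 2 ≤ n →
            ∫⁻ ω, wassersteinPow p (empiricalMeasure fun k => X k ω) μ ∂P ≤
              C * (tailTerm p μ M +
                ENNReal.ofReal (Real.log n / (n : ℝ) ^ (p / d)) *
                  truncatedTerm p ((d - p) / d) μ M)) ∧
          (p < d * (q - 1) / q →
            ∫⁻ ω, wassersteinPow p (empiricalMeasure fun k => X k ω) μ ∂P ≤
              C * (tailTerm p μ M +
                ENNReal.ofReal (1 / (n : ℝ) ^ (p / d)) *
                  truncatedTerm p ((d - p) / d) μ M)) := by
  have hq0 : 0 < q := by linarith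
  set s : ℝ := (q - 1) / q with hs_def
  have hs0 : 0 ≤ s := div_nonneg (by linarith) hq0.le
  have hs : s ≤ 1 / 2 := by rw [hs_def, div_le_iff₀ hq0]; linarith
  have hs1 : s < 1 := by linarith
  have h1s : 1 / q = 1 - s := by rw [hs_def]; field_simp; ring
  have hd0 : (0 : ℝ) < d := by exact_mod_cast hd
  have hds : d * (q - 1) / q = d * s := by rw [hs_def, mul_div_assoc]
  rw [h1s, hds]
  set B : ℝ := (4 * d) ^ p * (2 * 4 ^ d) * 2 ^ p with hB
  have hB0 : 0 < B := by positivity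
  have hBe : ∀ C : ℝ, 0 ≤ C → ENNReal.ofReal ((4 * d) ^ p) * (2 * 4 ^ d) * ENNReal.ofReal C *
      ENNReal.ofReal ((2 : ℝ) ^ p) = ((B * C).toNNReal : ℝ≥0∞) := by
    intro C hC
    have h24 : (2 * 4 ^ d : ℝ≥0∞) = ENNReal.ofReal (2 * 4 ^ d) := by
      rw [ENNReal.ofReal_mul zero_le_two, ENNReal.ofReal_pow (by norm_num)]; simp
    rw [h24, ← ENNReal.ofReal_mul (by positivity), ← ENNReal.ofReal_mul (by positivity),
      ← ENNReal.ofReal_mul (by positivity), ← ENNReal.ofReal, hB]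
    congr 1; ring
  -- The regime depends on `d`, `p` and `q` alone, so it may be settled before the constant is
  -- chosen; the other two claims are then vacuous.
  rcases lt_trichotomy (d * s) p with h | h | h
  · obtain ⟨C, hC, H⟩ := exists_level_bound_of_gt hp h
    refine ⟨(B * C).toNNReal, Real.toNNReal_pos.2 (by positivity), ?_⟩
    intro Ω _ P _ μ _ n X hn hX hI hμ hmom
    refine ⟨(measurable_wassersteinPow_empiricalMeasure hp hn hmom).comp
      (measurable_pi_lambda _ hX), fun M _ => ⟨fun _ => ?_, fun h' => ?_, fun h' => ?_⟩⟩
    · rw [← hBe C hC.le]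
      exact lintegral_wassersteinPow_empiricalMeasure_le hn hX hI hμ hp hs0 hs
        ENNReal.ofReal_ne_top (by linarith) (H n hn) M
    · exact absurd h' h.ne'
    · exact absurd h' h.not_gt
  · obtain ⟨C, hC, H⟩ := exists_level_bound_of_eq hp hs0 hs1 h.symm
    have hpd : p / d = s := by rw [← h]; field_simp
    have hdp : (d - p) / d = 1 - s := by rw [← h]; field_simp
    refine ⟨(B * C).toNNReal, Real.toNNReal_pos.2 (by positivity), ?_⟩
    intro Ω _ P _ μ _ n X hn hX hI hμ hmom
    refine ⟨(measurable_wassersteinPow_empiricalMeasure hp hn hmom).comp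
      (measurable_pi_lambda _ hX), fun M _ => ⟨fun h' => ?_, fun _ hn2 => ?_, fun h' => ?_⟩⟩
    · exact absurd h h'.ne
    · rw [← hBe C hC.le, hpd, hdp]
      exact lintegral_wassersteinPow_empiricalMeasure_le hn hX hI hμ hp hs0 hs
        ENNReal.ofReal_ne_top (by linarith) (H n hn2) M
    · exact absurd h h'.ne'
  · obtain ⟨C, hC, H⟩ := exists_level_bound_of_lt hd hp h
    have hdp : 0 ≤ (d - p) / d := div_nonneg (by nlinarith) hd0.le
    refine ⟨(B * C).toNNReal, Real.toNNReal_pos.2 (by positivity), ?_⟩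
    intro Ω _ P _ μ _ n X hn hX hI hμ hmom
    refine ⟨(measurable_wassersteinPow_empiricalMeasure hp hn hmom).comp
      (measurable_pi_lambda _ hX), fun M _ => ⟨fun h' => ?_, fun h' => ?_, fun _ => ?_⟩⟩
    · exact absurd h' h.not_gt
    · exact absurd h' h.ne
    · rw [← hBe C hC.le]
      exact lintegral_wassersteinPow_empiricalMeasure_le hn hX hI hμ hp hs0 hs
        ENNReal.ofReal_ne_top hdp (H n hn) M
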